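/- Let $(M,g)$ be a connected closed smooth Riemannian manifold with Riemannian distance $d_M$, and let $\Gamma$ be a finitely presented group acting on $M$ freely, minimally (every orbit is dense) and by isometries. Fix a finite symmetric generating set $S$ of $\Gamma$ and let $\|\cdot\|$ be the associated word length. For $t>0$ let $M_t=(tM\times\Gamma)/\Gamma$ be the level set of the warped cone, i.e. the quotient by the diagonal action $\gamma(x,h)=(\gamma x,\gamma h)$ of $M\times\Gamma$ with the metric $t\,d_M(x,y)+\|h^{-1}k\|$ between $(x,h)$ and $(y,k)$, equipped with the quotient metric; a point $p\in M$ is regarded as the class of $(p,e)$ in $M_t$, so that $d(p,q)=\inf_{\gamma\in\Gamma}\bigl(t\,d_M(p,\gamma q)+\|\gamma\|\bigr)$. For a metric space $X$, $p_0\in X$ and $r>0$, an $r$-loop based at $p_0$ is a finite sequence $(x_0,\dots,x_\ell)$ with $x_0=x_\ell=p_0$ and $d(x_i,x_{i+1})<r$ for all $i$. Two $r$-loops are $r$-close if one arises from the other by repeating the last point once more, or if they have the same length and corresponding points are at distance $<r$. Two $r$-loops based at $p_0$ are $r$-homotopic if they are joined by a finite sequence of $r$-loops based at $p_0$, consecutive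 ones being $r$-close. The coarse fundamental group $\pi_1(X,p_0;r)$ is the group of $r$-homotopy classes of $r$-loops based at $p_0$ under concatenation. Let $\pi:\widetilde M\to M$ be the universal cover of $M$, and let $\widetilde\Gamma$ be the group of lifts of $\Gamma$, that is, the group of all homeomorphisms $f$ of $\widetilde M$ for which there is $\gamma\in\Gamma$ with $\pi\circ f=\gamma\circ\pi$. Then: (1) There is $r_0>0$ such that for every $r\ge r_0$ there is $t_0>0$ such that for all $t\ge t_0$ and all $p_0\in M$ $$\pi_1(M_t,p_0;r)\cong\widetilde\Gamma .$$ (2) $\widetilde\Gamma$ is an extension of $\Gamma$ by $\pi_1(M)$: for every $p_0\in M$ there is a short exact sequence of groups $$1\to\pi_1(M,p_0)\to\widetilde\Gamma\xrightarrow{\ q\ }\Gamma\to1$$ in which $q(f)$ is the element $\gamma$ of $\Gamma$ with $\pi\circ f=\gamma\circ\pi$. -/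

import Mathlib

open scoped Manifold ContDiff Bundle

set_option linter.unusedSectionVars false

noncomputable section

/-! ### Coarse fundamental groups -/

section CoarsePi1

variable {X : Type*} [PseudoMetricSpace X]

/-- An `r`-path: a nonempty finite sequence of points with consecutive distances `< r`. -/
def IsRPath (r : ℝ) (l : List X) : Prop :=
  l ≠ [] ∧ l.IsChain (fun a b => dist a b < r)

/-- Repeat the last point of a path once more. -/
def endpointAppend (l : List X) : List X := l ++ l.getLast?.toList

/-- Two `r`-paths are `r`-close if one is the endpoint append of the other, or if they have the
same length and are pointwise at distance `< r`. -/
def RClose (r : ℝ) (α β : List X) : Prop :=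
  β = endpointAppend α ∨ α = endpointAppend β ∨ List.Forall₂ (fun a b => dist a b < r) α β

/-- `r`-loops based at `p₀`. -/
@[ext]
structure RLoop (p₀ : X) (r : ℝ) where
  points : List X
  isRPath : IsRPath r points
  head_eq : points.head? = some p₀
  last_eq : points.getLast? = some p₀

/-- `r`-homotopy based at `p₀`: a finite sequence of `r`-loops based at `p₀`, consecutive ones
being `r`-close. -/
def RHomotopic {p₀ : X} {r : ℝ} : RLoop p₀ r → RLoop p₀ r → Prop :=
  Relation.ReflTransGen (fun α β => RClose r α.points β.points)

theorem RClose.symm {r : ℝ} {α β : List X} (h : RClose r α β) : RClose r β α := by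
  rcases h with h | h | h
  · exact Or.inr (Or.inl h)
  · exact Or.inl h
  · refine Or.inr (Or.inr ?_)
    have := h.flip
    simpa only [dist_comm] using this

/-- The setoid of `r`-homotopy on `r`-loops. -/
def rHomotopySetoid (p₀ : X) (r : ℝ) : Setoid (RLoop p₀ r) where
  r := RHomotopic
  iseqv :=
    { refl := fun _ => Relation.ReflTransGen.refl
      symm := fun h => (@Relation.ReflTransGen.stdSymm _ _ ⟨fun _ _ h => h.symm⟩).symm _ _ h
      trans := fun h h' => Relation.ReflTransGen.trans h h' }

namespace RLoop

variable {p₀ : X} {r : ℝ}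

/-- The constant loop of length zero. -/
def one (p₀ : X) (r : ℝ) : RLoop p₀ r where
  points := [p₀]
  isRPath := ⟨by simp, by simp⟩
  head_eq := rfl
  last_eq := rfl

/-- Concatenation of `r`-loops. -/
def mul (hr : 0 < r) (α β : RLoop p₀ r) : RLoop p₀ r where
  points := α.points ++ β.points
  isRPath := by
    refine ⟨by simp [α.isRPath.1], List.IsChain.append α.isRPath.2 β.isRPath.2 ?_⟩
    intro x hx y hy
    rw [α.last_eq] at hx
    rw [β.head_eq] at hy
    simp only [Option.mem_def, Option.some.injEq] at hx hy
    subst hx; subst hy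
    simpa using hr
  head_eq := by simp [α.head_eq]
  last_eq := by simp [β.last_eq]

/-- The reversed loop. -/
def inv (α : RLoop p₀ r) : RLoop p₀ r where
  points := α.points.reverse
  isRPath := by
    refine ⟨by simp [α.isRPath.1], ?_⟩
    rw [List.isChain_reverse]
    simpa only [dist_comm] using α.isRPath.2
  head_eq := by simp [α.last_eq]
  last_eq := by simp [α.head_eq]

theorem endpointAppend_points (α : RLoop p₀ r) : endpointAppend α.points = α.points ++ [p₀] := by
  simp [endpointAppend, α.last_eq]

theorem close_of_forall₂ {α β : RLoop p₀ r}
    (h : List.Forall₂ (fun a b => dist a b < r) α.points β.points) : RHomotopic α β :=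
  Relation.ReflTransGen.single (Or.inr (Or.inr h))

theorem homotopic_symm {α β : RLoop p₀ r} (h : RHomotopic α β) : RHomotopic β α :=
  (rHomotopySetoid p₀ r).symm' h

theorem homotopic_append {α β : RLoop p₀ r} (h : β.points = α.points ++ [p₀]) :
    RHomotopic α β :=
  Relation.ReflTransGen.single (Or.inl (by rw [h, endpointAppend_points]))

theorem forall₂_dist_refl (hr : 0 < r) (l : List X) :
    List.Forall₂ (fun a b => dist a b < r) l l :=
  List.forall₂_same.2 (fun x _ => by simpa using hr)

theorem forall₂_shift {R : X → X → Prop} {b : X} :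
    ∀ (a : X) (l : List X), (a :: l).IsChain R → (∀ c ∈ (a :: l).getLast?, R c b) →
      List.Forall₂ R (a :: l) (l ++ [b])
  | a, [], _, h => by simpa using h
  | a, c :: l, h, h' => by
      rw [List.isChain_cons_cons] at h
      refine List.Forall₂.cons h.1 (forall₂_shift c l h.2 ?_)
      simpa using h'

/-- Moving a repeated base point from the start of a loop to its end. -/
theorem forall₂_rotate (hr : 0 < r) (α : RLoop p₀ r) :
    List.Forall₂ (fun a b => dist a b < r) ([p₀] ++ α.points) (α.points ++ [p₀]) := by
  refine forall₂_shift p₀ α.points ((mul hr (one p₀ r) α).isRPath.2) ?_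
  have h := (mul hr (one p₀ r) α).last_eq
  change (p₀ :: α.points).getLast? = some p₀ at h
  intro c hc
  rw [h] at hc
  simp only [Option.mem_def, Option.some.injEq] at hc
  subst hc
  simpa using hr

theorem mul_one_homotopic (hr : 0 < r) (α : RLoop p₀ r) :
    RHomotopic (mul hr α (one p₀ r)) α :=
  homotopic_symm (homotopic_append rfl)

theorem one_mul_homotopic (hr : 0 < r) (α : RLoop p₀ r) :
    RHomotopic (mul hr (one p₀ r) α) α :=
  Relation.ReflTransGen.trans
    (close_of_forall₂ (β := mul hr α (one p₀ r)) (forall₂_rotate hr α))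
    (mul_one_homotopic hr α)

theorem mul_right_congr (hr : 0 < r) (α : RLoop p₀ r) {β β' : RLoop p₀ r}
    (h : RHomotopic β β') : RHomotopic (mul hr α β) (mul hr α β') := by
  refine Relation.ReflTransGen.lift' (mul hr α) ?_ _ _ h
  rintro β β' (h | h | h)
  · rw [endpointAppend_points] at h
    exact homotopic_append (by simp [mul, h])
  · rw [endpointAppend_points] at h
    exact homotopic_symm (homotopic_append (by simp [mul, h]))
  · exact close_of_forall₂ (List.rel_append (forall₂_dist_refl hr _) h)

theorem mul_append_left (hr : 0 < r) {α α' : RLoop p₀ r} (β : RLoop p₀ r)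
    (h : α'.points = α.points ++ [p₀]) : RHomotopic (mul hr α' β) (mul hr α β) := by
  have h1 : RHomotopic (mul hr α' β) (mul hr α (mul hr β (one p₀ r))) := by
    refine close_of_forall₂ ?_
    simp only [mul, h, List.append_assoc, one]
    exact List.rel_append (forall₂_dist_refl hr _) (forall₂_rotate hr β)
  exact Relation.ReflTransGen.trans h1 (mul_right_congr hr α (mul_one_homotopic hr β))

theorem mul_left_congr (hr : 0 < r) {α α' : RLoop p₀ r} (β : RLoop p₀ r)
    (h : RHomotopic α α') : RHomotopic (mul hr α β) (mul hr α' β) := by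
  refine Relation.ReflTransGen.lift' (fun α => mul hr α β) ?_ _ _ h
  rintro α α' (h | h | h)
  · rw [endpointAppend_points] at h
    exact homotopic_symm (mul_append_left hr β h)
  · rw [endpointAppend_points] at h
    exact mul_append_left hr β h
  · exact close_of_forall₂ (List.rel_append h (forall₂_dist_refl hr _))

theorem inv_congr (hr : 0 < r) {α α' : RLoop p₀ r} (h : RHomotopic α α') :
    RHomotopic (inv α) (inv α') := by
  have key : ∀ {α α' : RLoop p₀ r}, α'.points = α.points ++ [p₀] →
      RHomotopic (inv α') (inv α) := by
    intro α α' h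
    have e : inv α' = mul hr (one p₀ r) (inv α) := by
      ext1
      simp [inv, mul, one, h]
    rw [e]
    exact one_mul_homotopic hr _
  refine Relation.ReflTransGen.lift' inv ?_ _ _ h
  rintro α α' (h | h | h)
  · rw [endpointAppend_points] at h
    exact homotopic_symm (key h)
  · rw [endpointAppend_points] at h
    exact key h
  · exact close_of_forall₂ (List.rel_reverse h)

theorem isChain_palindrome (hr : 0 < r) (l : List X) (c : X) (k : ℕ)
    (h : (l ++ [c]).IsChain (fun a b => dist a b < r)) :
    (l ++ (List.replicate (k + 1) c ++ l.reverse)).IsChain (fun a b => dist a b < r) := by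
  have hl := (List.isChain_append.1 h)
  have hc : (List.replicate (k + 1) c).IsChain (fun a b => dist a b < r) :=
    List.isChain_replicate_of_rel _ (by simpa using hr)
  have hl' : l.reverse.IsChain (fun a b => dist a b < r) := by
    rw [List.isChain_reverse]
    simpa only [dist_comm] using hl.1
  refine List.IsChain.append hl.1 (List.IsChain.append hc hl' ?_) ?_
  · intro x hx y hy
    have hx' : x = c := by
      have := List.mem_of_getLast? hx
      exact List.eq_of_mem_replicate this
    subst hx'
    rw [dist_comm]
    exact hl.2.2 y (by simpa using hy) x (by simp)
  · intro x hx y hy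
    refine hl.2.2 x hx y ?_
    simpa [List.replicate_succ] using hy

theorem replicate_homotopic (hr : 0 < r) : ∀ (k : ℕ) (γ : RLoop p₀ r),
    γ.points = List.replicate (k + 1) p₀ → RHomotopic γ (one p₀ r)
  | 0, γ, h => by
      have e : γ = one p₀ r := by
        ext1
        simpa [one] using h
      rw [e]
      exact Relation.ReflTransGen.refl
  | k + 1, γ, h => by
      let δ : RLoop p₀ r :=
        { points := List.replicate (k + 1) p₀
          isRPath := ⟨by simp, List.isChain_replicate_of_rel _ (by simpa using hr)⟩
          head_eq := by simp [List.replicate_succ]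
          last_eq := by simp [List.replicate_succ'] }
      refine Relation.ReflTransGen.trans (homotopic_symm (homotopic_append (α := δ) ?_))
        (replicate_homotopic hr k δ rfl)
      rw [h, List.replicate_succ']

theorem palindrome_homotopic (hr : 0 < r) (l : List X) : ∀ (c : X) (k : ℕ) (γ : RLoop p₀ r),
    (l ++ [c]).IsChain (fun a b => dist a b < r) → (l ++ [c]).head? = some p₀ →
    γ.points = l ++ (List.replicate (k + 1) c ++ l.reverse) → RHomotopic γ (one p₀ r) := by
  induction l using List.reverseRecOn with
  | nil =>
    intro c k γ _ hh hγ
    simp only [List.nil_append, List.head?_cons, Option.some.injEq] at hh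
    subst hh
    exact replicate_homotopic hr k γ (by simpa using hγ)
  | append_singleton m b ih =>
    intro c k γ hc hh hγ
    have hbc : dist b c < r := (List.isChain_append.1 hc).2.2 b (by simp) c (by simp)
    have hm : (m ++ [b]).IsChain (fun a b => dist a b < r) := (List.isChain_append.1 hc).1
    have hmh : (m ++ [b]).head? = some p₀ := by
      cases m <;> simpa using hh
    let δ : RLoop p₀ r :=
      { points := m ++ (List.replicate (k + 2 + 1) b ++ m.reverse)
        isRPath := ⟨by simp [List.replicate_succ], isChain_palindrome hr m b _ hm⟩
        head_eq := by
          cases m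
          · simpa [List.replicate_succ] using hmh
          · simpa using hmh
        last_eq := by
          cases m
          · simpa [List.replicate_succ'] using hmh
          · simp only [List.cons_append, List.head?_cons, Option.some.injEq] at hmh
            subst hmh
            rw [List.reverse_cons, ← List.append_assoc, ← List.append_assoc,
              List.getLast?_append]
            rfl }
    refine Relation.ReflTransGen.trans (close_of_forall₂ (β := δ) ?_) (ih b (k + 2) δ hm hmh rfl)
    have e1 : γ.points = m ++ (([b] ++ (List.replicate (k + 1) c ++ [b])) ++ m.reverse) := by
      rw [hγ]; simp
    have e2 : δ.points = m ++ (([b] ++ (List.replicate (k + 1) b ++ [b])) ++ m.reverse) := by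
      change m ++ (List.replicate (k + 2 + 1) b ++ m.reverse) = _
      rw [← List.replicate_succ', List.singleton_append, ← List.replicate_succ]
    rw [e1, e2]
    have hrep : ∀ j : ℕ, List.Forall₂ (fun a b => dist a b < r)
        (List.replicate j c) (List.replicate j b) := by
      intro j
      induction j with
      | zero => exact List.Forall₂.nil
      | succ j ih => exact List.Forall₂.cons (by rw [dist_comm]; exact hbc) ih
    have rf := forall₂_dist_refl (X := X) hr
    exact List.rel_append (rf _) (List.rel_append (List.rel_append (rf _)
      (List.rel_append (hrep _) (rf _))) (rf _))

theorem mul_inv_homotopic (hr : 0 < r) (α : RLoop p₀ r) :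
    RHomotopic (mul hr α (inv α)) (one p₀ r) := by
  obtain ⟨l, hl⟩ : ∃ l, α.points = l ++ [p₀] := List.getLast?_eq_some_iff.1 α.last_eq
  refine palindrome_homotopic hr l p₀ 1 _ (hl ▸ α.isRPath.2) (hl ▸ α.head_eq) ?_
  simp [mul, inv, hl, List.replicate_succ]

end RLoop

/-- The coarse fundamental group of `X` based at `p₀`, of scale `r > 0`. -/
def CoarsePi1 (p₀ : X) (r : ℝ) (_hr : 0 < r) : Type _ := Quotient (rHomotopySetoid p₀ r)

instance CoarsePi1.instGroup (p₀ : X) (r : ℝ) (hr : 0 < r) : Group (CoarsePi1 p₀ r hr) where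
  mul := Quotient.map₂ (RLoop.mul hr) (fun _ _ h₁ _ _ h₂ =>
    Relation.ReflTransGen.trans (RLoop.mul_left_congr hr _ h₁) (RLoop.mul_right_congr hr _ h₂))
  one := Quotient.mk _ (RLoop.one p₀ r)
  inv := Quotient.map RLoop.inv (fun _ _ h => RLoop.inv_congr hr h)
  mul_assoc := by
    rintro ⟨a⟩ ⟨b⟩ ⟨c⟩
    refine congrArg (Quotient.mk _) ?_
    ext1
    simp [RLoop.mul]
  one_mul := by
    rintro ⟨a⟩
    exact Quotient.sound (RLoop.one_mul_homotopic hr a)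
  mul_one := by
    rintro ⟨a⟩
    exact Quotient.sound (RLoop.mul_one_homotopic hr a)
  inv_mul_cancel := by
    rintro ⟨a⟩
    refine Quotient.sound ?_
    have h := RLoop.mul_inv_homotopic hr (RLoop.inv a)
    have e : RLoop.inv (RLoop.inv a) = a := by
      ext1
      simp [RLoop.inv]
    rwa [e] at h

end CoarsePi1

/-! ### Word metrics and level sets of warped cones -/

/-- A finite symmetric generating set of a group. -/
structure FiniteSymmGenSet (Γ : Type*) [Group Γ] where
  carrier : Set Γ
  finite : carrier.Finite
  inv_mem : ∀ s ∈ carrier, s⁻¹ ∈ carrier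
  closure_eq_top : Subgroup.closure carrier = ⊤

namespace FiniteSymmGenSet

variable {Γ : Type*} [Group Γ] (S : FiniteSymmGenSet Γ)

/-- The word length `‖γ‖`: least length of a word in the generators representing `γ`. -/
def wordLength (γ : Γ) : ℕ :=
  sInf {n | ∃ l : List Γ, (∀ s ∈ l, s ∈ S.carrier) ∧ l.prod = γ ∧ l.length = n}

/-- The (left-invariant) word metric. -/
def wordDist (g h : Γ) : ℕ := S.wordLength (g⁻¹ * h)

theorem exists_word (γ : Γ) : ∃ l : List Γ, (∀ s ∈ l, s ∈ S.carrier) ∧ l.prod = γ := by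
  have h : γ ∈ Subgroup.closure S.carrier := by rw [S.closure_eq_top]; trivial
  rw [← Subgroup.mem_toSubmonoid, Subgroup.closure_toSubmonoid] at h
  obtain ⟨l, hl, rfl⟩ := Submonoid.exists_list_of_mem_closure h
  refine ⟨l, fun s hs => ?_, rfl⟩
  rcases hl s hs with h | h
  · exact h
  · simpa using S.inv_mem _ h

theorem exists_word_length (γ : Γ) :
    ∃ l : List Γ, (∀ s ∈ l, s ∈ S.carrier) ∧ l.prod = γ ∧ l.length = S.wordLength γ := by
  obtain ⟨l, hl, hp⟩ := S.exists_word γ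
  exact Nat.sInf_mem
    (s := {n | ∃ l : List Γ, (∀ s ∈ l, s ∈ S.carrier) ∧ l.prod = γ ∧ l.length = n})
    ⟨l.length, l, hl, hp, rfl⟩

theorem wordLength_le {l : List Γ} (hl : ∀ s ∈ l, s ∈ S.carrier) :
    S.wordLength l.prod ≤ l.length :=
  Nat.sInf_le ⟨l, hl, rfl, rfl⟩

theorem wordLength_one : S.wordLength 1 = 0 :=
  Nat.le_zero.1 (S.wordLength_le (l := []) (by simp))

theorem eq_one_of_wordLength_eq_zero {γ : Γ} (h : S.wordLength γ = 0) : γ = 1 := by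
  obtain ⟨l, _, hp, hn⟩ := S.exists_word_length γ
  rw [h, List.length_eq_zero_iff] at hn
  subst hn
  simpa using hp.symm

theorem wordLength_mul_le (a b : Γ) :
    S.wordLength (a * b) ≤ S.wordLength a + S.wordLength b := by
  obtain ⟨l, hl, hp, hn⟩ := S.exists_word_length a
  obtain ⟨l', hl', hp', hn'⟩ := S.exists_word_length b
  have := S.wordLength_le (l := l ++ l') (by
    intro s hs
    rcases List.mem_append.1 hs with h | h
    · exact hl s h
    · exact hl' s h)
  simpa [hp, hp', hn, hn'] using this

theorem wordLength_inv_le (a : Γ) : S.wordLength a⁻¹ ≤ S.wordLength a := by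
  obtain ⟨l, hl, hp, hn⟩ := S.exists_word_length a
  have := S.wordLength_le (l := (l.map (fun x => x⁻¹)).reverse) (by
    intro s hs
    simp only [List.mem_reverse, List.mem_map] at hs
    obtain ⟨x, hx, rfl⟩ := hs
    exact S.inv_mem x (hl x hx))
  rw [← List.prod_inv_reverse, hp] at this
  simpa [hn] using this

theorem wordDist_self (g : Γ) : S.wordDist g g = 0 := by
  simp [wordDist, wordLength_one]

theorem wordDist_comm (g h : Γ) : S.wordDist g h = S.wordDist h g := by
  have key : ∀ a b : Γ, S.wordDist a b ≤ S.wordDist b a := by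
    intro a b
    have := S.wordLength_inv_le (b⁻¹ * a)
    simpa [wordDist] using this
  exact le_antisymm (key g h) (key h g)

theorem wordDist_triangle (a b c : Γ) :
    S.wordDist a c ≤ S.wordDist a b + S.wordDist b c := by
  have := S.wordLength_mul_le (a⁻¹ * b) (b⁻¹ * c)
  simpa [wordDist, mul_assoc] using this

theorem wordDist_smul (γ a b : Γ) : S.wordDist (γ * a) (γ * b) = S.wordDist a b := by
  simp [wordDist, mul_assoc]

theorem eq_of_wordDist_eq_zero {a b : Γ} (h : S.wordDist a b = 0) : a = b :=
  (inv_mul_eq_one.1 (S.eq_one_of_wordLength_eq_zero h))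

end FiniteSymmGenSet

section LevelSet

variable {Γ : Type*} [Group Γ] (S : FiniteSymmGenSet Γ) {M : Type*} [MetricSpace M] [MulAction Γ M]

/-- The distance on the product `tM × Γ`. -/
def productDist (t : ℝ) (a b : M × Γ) : ℝ := t * dist a.1 b.1 + S.wordDist a.2 b.2

variable (M) in
/-- The level set `M_t = (tM × Γ) / Γ`, the quotient by the diagonal action
`γ • (x, g) = (γ • x, γ * g)`. -/
def LevelSet (_S : FiniteSymmGenSet Γ) (t : ℝ) (_ht : 0 < t) : Type _ :=
  MulAction.orbitRel.Quotient Γ (M × Γ)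

variable {t : ℝ} (ht : 0 < t)

namespace LevelSet

/-- The class of a pair `(x, g)`. -/
def mk (a : M × Γ) : LevelSet M S t ht :=
  (Quotient.mk (MulAction.orbitRel Γ (M × Γ)) a : MulAction.orbitRel.Quotient Γ (M × Γ))

/-- A point `p` of `M`, seen in the level set as the class of `(p, 1)`. -/
def ofPoint (p : M) : LevelSet M S t ht := mk S ht (p, 1)

variable {S ht}

/-- The quotient distance: infimum of the distances between representatives. -/
instance : Dist (LevelSet M S t ht) where
  dist u v := sInf {d : ℝ | ∃ a b : M × Γ, mk S ht a = u ∧ mk S ht b = v ∧ productDist S t a b = d}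

theorem mk_surjective (u : LevelSet M S t ht) : ∃ a, mk S ht a = u :=
  Quotient.exists_rep u

theorem mk_eq_iff {a b : M × Γ} : mk S ht a = mk S ht b ↔ ∃ γ : Γ, γ • b = a :=
  Quotient.eq (r := MulAction.orbitRel Γ (M × Γ))

theorem productDist_nonneg (ht : 0 < t) (a b : M × Γ) : 0 ≤ productDist S t a b := by
  unfold productDist
  positivity

theorem dist_le (a b : M × Γ) : dist (mk S ht a) (mk S ht b) ≤ productDist S t a b :=
  csInf_le ⟨0, by rintro _ ⟨a, b, -, -, rfl⟩; exact productDist_nonneg ht a b⟩ ⟨a, b, rfl, rfl, rfl⟩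

theorem exists_lt {u v : LevelSet M S t ht} {c : ℝ} (h : dist u v < c) :
    ∃ a b : M × Γ, mk S ht a = u ∧ mk S ht b = v ∧ productDist S t a b < c := by
  obtain ⟨a, ha⟩ := mk_surjective u
  obtain ⟨b, hb⟩ := mk_surjective v
  obtain ⟨_, ⟨a, b, ha, hb, rfl⟩, hlt⟩ := exists_lt_of_csInf_lt
    (s := {d : ℝ | ∃ a b : M × Γ, mk S ht a = u ∧ mk S ht b = v ∧ productDist S t a b = d})
    ⟨_, a, b, ha, hb, rfl⟩ h
  exact ⟨a, b, ha, hb, hlt⟩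

theorem dist_nonneg' (u v : LevelSet M S t ht) : 0 ≤ dist u v :=
  Real.sInf_nonneg (by rintro _ ⟨a, b, -, -, rfl⟩; exact productDist_nonneg ht a b)

theorem dist_comm_le (u v : LevelSet M S t ht) : dist u v ≤ dist v u := by
  refine le_of_forall_gt_imp_ge_of_dense (fun c hc => ?_)
  obtain ⟨a, b, rfl, rfl, h⟩ := exists_lt hc
  refine (dist_le b a).trans (le_trans (le_of_eq ?_) h.le)
  simp [productDist, dist_comm, S.wordDist_comm]

variable [IsIsometricSMul Γ M]

theorem productDist_smul (γ : Γ) (a b : M × Γ) :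
    productDist S t (γ • a) (γ • b) = productDist S t a b := by
  simp [productDist, dist_smul, S.wordDist_smul]

theorem productDist_triangle (ht : 0 < t) (a b c : M × Γ) :
    productDist S t a c ≤ productDist S t a b + productDist S t b c := by
  have h1 := mul_le_mul_of_nonneg_left (dist_triangle a.1 b.1 c.1) ht.le
  have h2 : (S.wordDist a.2 c.2 : ℝ) ≤ S.wordDist a.2 b.2 + S.wordDist b.2 c.2 := by
    exact_mod_cast S.wordDist_triangle a.2 b.2 c.2
  unfold productDist
  linarith

theorem exists_lt_left {a : M × Γ} {v : LevelSet M S t ht} {c : ℝ} (h : dist (mk S ht a) v < c) :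
    ∃ b : M × Γ, mk S ht b = v ∧ productDist S t a b < c := by
  obtain ⟨a', b, ha, hb, hlt⟩ := exists_lt h
  obtain ⟨γ, rfl⟩ := mk_eq_iff.1 ha
  refine ⟨γ⁻¹ • b, ?_, ?_⟩
  · rw [← hb]
    exact mk_eq_iff.2 ⟨γ⁻¹, rfl⟩
  · rw [← productDist_smul γ]
    simpa using hlt

theorem dist_triangle' (u v w : LevelSet M S t ht) : dist u w ≤ dist u v + dist v w := by
  refine le_of_forall_pos_le_add (fun ε hε => ?_)
  obtain ⟨a, b, rfl, rfl, h⟩ := exists_lt (u := u) (v := v) (c := dist u v + ε / 2) (by linarith)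
  obtain ⟨c, rfl, h'⟩ := exists_lt_left
    (a := b) (v := w) (c := dist (mk S ht b) w + ε / 2) (by linarith)
  have h1 := dist_le (S := S) (ht := ht) a c
  have h2 := productDist_triangle (S := S) ht a b c
  linarith

theorem eq_of_dist_eq_zero' {u v : LevelSet M S t ht} (h : dist u v = 0) : u = v := by
  obtain ⟨⟨x, g⟩, rfl⟩ := mk_surjective u
  have key : ∀ ε : ℝ, 0 < ε → ε ≤ 1 →
      ∃ y : M, mk S ht (y, g) = v ∧ t * dist x y < ε := by
    intro ε hε hε1
    obtain ⟨⟨y, g'⟩, hv, hlt⟩ := exists_lt_left (c := ε) (by rw [h]; exact hε)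
    have h0 : 0 ≤ t * dist x y := by positivity
    simp only [productDist] at hlt
    have hw : S.wordDist g g' = 0 := by
      have : (S.wordDist g g' : ℝ) < 1 := by linarith
      have : S.wordDist g g' < 1 := by exact_mod_cast this
      omega
    have hg := S.eq_of_wordDist_eq_zero hw
    subst hg
    refine ⟨y, hv, ?_⟩
    have : (0 : ℝ) ≤ S.wordDist g g := Nat.cast_nonneg _
    linarith
  obtain ⟨y, hy, -⟩ := key 1 one_pos le_rfl
  have hle : dist x y ≤ 0 := by
    refine le_of_forall_pos_le_add (fun ε hε => ?_)
    obtain ⟨z, hz, hlt⟩ := key (min 1 (t * ε)) (lt_min one_pos (by positivity)) (min_le_left _ _)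
    obtain ⟨γ, hγ⟩ := mk_eq_iff.1 (hz.trans hy.symm)
    obtain ⟨h1, h2⟩ := Prod.mk.inj hγ
    have hγ1 : γ = 1 := by simpa using h2
    subst hγ1
    have hzy : y = z := by simpa using h1
    subst hzy
    have h3 : t * dist x y < t * ε := lt_of_lt_of_le hlt (min_le_right _ _)
    have := lt_of_mul_lt_mul_left h3 ht.le
    linarith
  have hxy : x = y := dist_le_zero.1 hle
  rw [hxy, hy]

instance : MetricSpace (LevelSet M S t ht) where
  dist_self u := by
    obtain ⟨a, rfl⟩ := mk_surjective u
    refine le_antisymm ?_ (dist_nonneg' _ _)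
    refine (dist_le a a).trans (le_of_eq ?_)
    simp [productDist, S.wordDist_self]
  dist_comm u v := le_antisymm (dist_comm_le u v) (dist_comm_le v u)
  dist_triangle := dist_triangle'
  eq_of_dist_eq_zero := eq_of_dist_eq_zero'

end LevelSet

end LevelSet

/-! ### Universal covers and groups of lifts -/

/-- `p : E → M` is a universal cover: a covering map with simply connected total space. -/
def IsUniversalCover {E M : Type*} [TopologicalSpace E] [TopologicalSpace M] (p : E → M) : Prop :=
  IsCoveringMap p ∧ SimplyConnectedSpace E

/-- The group of lifts of `Γ` along `p : E → M`: all homeomorphisms of `E` which cover the action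
on `M` of some `γ : Γ`. -/
def liftGroup (Γ : Type*) [Group Γ] {E M : Type*} [TopologicalSpace E] [MulAction Γ M]
    (p : E → M) : Subgroup (E ≃ₜ E) where
  carrier := {f | ∃ γ : Γ, ∀ e, p (f e) = γ • p e}
  one_mem' := ⟨1, fun e => by simp⟩
  mul_mem' := by
    rintro f g ⟨γ, hγ⟩ ⟨η, hη⟩
    exact ⟨γ * η, fun e => by rw [Homeomorph.mul_apply, hγ, hη, mul_smul]⟩
  inv_mem' := by
    rintro f ⟨γ, hγ⟩
    refine ⟨γ⁻¹, fun e => ?_⟩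
    rw [eq_inv_smul_iff, ← hγ, ← Homeomorph.mul_apply, mul_inv_cancel, Homeomorph.one_apply]

end

/-! The level set is the quotient of `E × Γ` by the diagonal action of the group of lifts, and at
scale `r` this product plays the role of its universal cover. Two of its points are adjacent
(`CoverEdge`) when a connected subset of `E` with small image joins their first coordinates and the
total cost stays below `r`. For `t` large compared with `r`, squares lift to closed squares: they
have no room to change sheet, and by freeness and compactness no short nontrivial element of `Γ`
moves a point so little (`CoverEdge.eq_one_of_square`). Lifting loops therefore gives a homomorphism
from the coarse fundamental group to the group of lifts. It is onto because `E × Γ` is connected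
through edges.

Injectivity is obtained from cocycles rather than from explicit homotopies. A choice of base paths
gives a tautological cocycle `edgeClass` with values in the coarse fundamental group, whose product
along a loop is a conjugate of the class of that loop. Once its pullback to `E × Γ` is a coboundary,
a loop with a closed lift has trivial class (`IsCoarseRegularCover.nonempty_mulEquiv`). The pullback
is a coboundary on each `{e} × Γ` because `r` exceeds the lengths occurring in a finite presentation
(`exists_scale_isCocycle_trivial`), and locally on `E × {1}` because a covering of the simply
connected space `E` has a section (`exists_locally_coboundary`). The two solutions are matched
across thin rectangles (`levelProj_cocycle_trivial`).

For the extension, the kernel of the map to `Γ` is the deck group of the universal cover, and every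
element of `Γ` lifts because `E` is simply connected. -/

/-! ### Products along discrete paths -/

section PathProd

variable {X K : Type*} [Group K]

/-- The ordered product of the values of `c` over the steps of a discrete path. -/
def pathProd (c : X → X → K) : List X → K
  | [] => 1
  | [_] => 1
  | a :: b :: l => c a b * pathProd c (b :: l)

@[simp] theorem pathProd_singleton (c : X → X → K) (a : X) : pathProd c [a] = 1 := rfl

@[simp] theorem pathProd_cons_cons (c : X → X → K) (a b : X) (l : List X) :
    pathProd c (a :: b :: l) = c a b * pathProd c (b :: l) := rfl

theorem pathProd_append (c : X → X → K) (a : X) (m : List X) :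
    ∀ l : List X, pathProd c (l ++ a :: m) = pathProd c (l ++ [a]) * pathProd c (a :: m)
  | [] => by simp
  | [b] => by simp
  | b :: b' :: l => by
      have := pathProd_append c a m (b' :: l)
      simp only [List.cons_append, pathProd_cons_cons] at this ⊢
      rw [this, mul_assoc]

end PathProd

/-! ### Homotopy invariance of products along loops, and elementary moves on loops -/

section CoarseCocycles

variable {X : Type*} [PseudoMetricSpace X] {K : Type*} [Group K] {r : ℝ}

/-- Two close paths bound a ladder of squares; the rung is pushed across one square at a time.
Squares rather than triangles are needed, since the diagonals may be longer than `r`. -/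
theorem pathProd_forall₂ {c : X → X → K}
    (hsq : ∀ a b a' b', dist a b < r → dist a' b' < r → dist a a' < r → dist b b' < r →
      c a b * c b b' = c a a' * c a' b') :
    ∀ (l m : List X) (a b x y : X), (a :: l).IsChain (fun a b => dist a b < r) →
      (b :: m).IsChain (fun a b => dist a b < r) →
      List.Forall₂ (fun a b => dist a b < r) (a :: l) (b :: m) →
      (a :: l).getLast? = some x → (b :: m).getLast? = some y →
      pathProd c (a :: l) * c x y = c a b * pathProd c (b :: m)
  | [], m, a, b, x, y, _, _, h, hx, hy => by
      simp only [List.forall₂_cons, List.forall₂_nil_left_iff] at h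
      obtain ⟨_, rfl⟩ := h
      simp_all
  | a' :: l, [], a, b, x, y, _, _, h, hx, hy => by
      simp at h
  | a' :: l, b' :: m, a, b, x, y, hl, hm, h, hx, hy => by
      rw [List.isChain_cons_cons] at hl hm
      have h' := List.forall₂_cons.1 h
      have h'' := List.forall₂_cons.1 h'.2
      have ih := pathProd_forall₂ hsq l m a' b' x y hl.2 hm.2 h'.2 (by simpa using hx)
        (by simpa using hy)
      rw [pathProd_cons_cons, pathProd_cons_cons, mul_assoc, ih, ← mul_assoc, ← mul_assoc,
        hsq a a' b b' hl.1 hm.1 h'.1 h''.1]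

namespace RLoop

variable {p₀ : X}

theorem exists_points_eq_cons (α : RLoop p₀ r) : ∃ l, α.points = p₀ :: l :=
  List.head?_eq_some_iff.1 α.head_eq

theorem exists_points_eq_append (α : RLoop p₀ r) : ∃ l, α.points = l ++ [p₀] :=
  List.getLast?_eq_some_iff.1 α.last_eq

theorem pathProd_mul (hr : 0 < r) {c : X → X → K} (hc : ∀ a, c a a = 1) (α β : RLoop p₀ r) :
    pathProd c (mul hr α β).points = pathProd c α.points * pathProd c β.points := by
  obtain ⟨l, hl⟩ := α.exists_points_eq_append
  obtain ⟨m, hm⟩ := β.exists_points_eq_cons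
  simp only [mul, hl, hm, List.append_assoc, List.singleton_append]
  rw [pathProd_append, pathProd_cons_cons, hc, one_mul]

theorem pathProd_eq_of_homotopic {c : X → X → K} (hc : ∀ a, c a a = 1)
    (hsq : ∀ a b a' b', dist a b < r → dist a' b' < r → dist a a' < r → dist b b' < r →
      c a b * c b b' = c a a' * c a' b') {α β : RLoop p₀ r} (h : RHomotopic α β) :
    pathProd c α.points = pathProd c β.points := by
  have happ : ∀ {α β : RLoop p₀ r}, β.points = endpointAppend α.points →
      pathProd c α.points = pathProd c β.points := by
    intro α β h
    obtain ⟨l, hl⟩ := α.exists_points_eq_append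
    rw [h, endpointAppend_points, hl, List.append_assoc, List.singleton_append,
      pathProd_append c p₀ [p₀] l, pathProd_cons_cons, hc]
    simp
  induction h with
  | refl => rfl
  | @tail β γ _ h ih =>
    rw [ih]
    rcases h with h | h | h
    · exact happ h
    · exact (happ h).symm
    · obtain ⟨l, hl⟩ := β.exists_points_eq_cons
      obtain ⟨m, hm⟩ := γ.exists_points_eq_cons
      have := pathProd_forall₂ hsq l m p₀ p₀ p₀ p₀ (hl ▸ β.isRPath.2) (hm ▸ γ.isRPath.2)
        (hl ▸ hm ▸ h) (hl ▸ β.last_eq) (hm ▸ γ.last_eq)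
      rw [hl, hm]
      simpa [hc] using this

theorem homotopic_of_points_eq {α β : RLoop p₀ r} (h : α.points = β.points) : RHomotopic α β := by
  rw [RLoop.ext h]
  exact Relation.ReflTransGen.refl

/-- A loop with the given points whose ends agree with those of another loop. -/
def ofPoints (l : List X) (hl : l.IsChain (fun a b => dist a b < r)) (h0 : l.head? = some p₀)
    (h1 : l.getLast? = some p₀) : RLoop p₀ r :=
  ⟨l, ⟨by rintro rfl; simp at h0, hl⟩, h0, h1⟩

/-- Append the base point to the shortened loop. Both lists then have the same length, and past the
repetition they differ by a shift of one step, which moves each point by less than `r`. -/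
theorem exists_delete_repetition (hr : 0 < r) (α : RLoop p₀ r) {l m : List X} {a : X}
    (h : α.points = l ++ a :: a :: m) :
    ∃ β : RLoop p₀ r, β.points = l ++ a :: m ∧ RHomotopic α β := by
  have hch := α.isRPath.2
  have hh := α.head_eq
  have hla := α.last_eq
  rw [h] at hch hh hla
  obtain ⟨h1, h2, h3⟩ := List.isChain_append.1 hch
  have h2' := (List.isChain_cons_cons.1 h2).2
  let β : RLoop p₀ r := ofPoints (l ++ a :: m)
    (List.isChain_append.2 ⟨h1, h2', fun x hx y hy => h3 x hx y (by simpa using hy)⟩)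
    (by cases l <;> simpa using hh) (by simpa using hla)
  refine ⟨β, rfl, Relation.ReflTransGen.trans
    (close_of_forall₂ (β := mul hr β (one p₀ r)) ?_) (mul_one_homotopic hr β)⟩
  have e : (mul hr β (one p₀ r)).points = l ++ (a :: m ++ [p₀]) := by
    simp [mul, one, β, ofPoints]
  rw [h, e]
  refine List.rel_append (forall₂_dist_refl hr l) (forall₂_shift a (a :: m) h2 ?_)
  intro c hc
  have : (a :: a :: m).getLast? = some p₀ := by simpa using hla
  rw [this] at hc
  simp only [Option.mem_def, Option.some.injEq] at hc
  subst hc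
  simpa using hr

/-- Slide `b` onto `a`, then remove the repetition. -/
theorem exists_delete_middle (hr : 0 < r) (α : RLoop p₀ r) {l m : List X} {a b d : X}
    (h : α.points = l ++ a :: b :: d :: m) (had : dist a d < r) :
    ∃ β : RLoop p₀ r, β.points = l ++ a :: d :: m ∧ RHomotopic α β := by
  have hch := α.isRPath.2
  have hh := α.head_eq
  have hla := α.last_eq
  rw [h] at hch hh hla
  obtain ⟨h1, h2, h3⟩ := List.isChain_append.1 hch
  obtain ⟨hab, h2⟩ := List.isChain_cons_cons.1 h2
  obtain ⟨hbd, h2⟩ := List.isChain_cons_cons.1 h2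
  let γ : RLoop p₀ r := ofPoints (l ++ a :: a :: d :: m)
    (List.isChain_append.2 ⟨h1, List.isChain_cons_cons.2 ⟨by simpa using hr,
      List.isChain_cons_cons.2 ⟨had, h2⟩⟩, fun x hx y hy => h3 x hx y (by simpa using hy)⟩)
    (by cases l <;> simpa using hh) (by simpa using hla)
  obtain ⟨β, hβ, hγβ⟩ := exists_delete_repetition hr γ rfl
  refine ⟨β, hβ, Relation.ReflTransGen.trans (close_of_forall₂ ?_) hγβ⟩
  rw [h]
  refine List.rel_append (forall₂_dist_refl hr l) ?_
  exact List.Forall₂.cons (by simpa using hr) (List.Forall₂.cons (by rwa [dist_comm])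
    (forall₂_dist_refl hr _))

/-- A backtracking excursion is cancelled from its turning point outwards: `y, x, y` becomes `y, y`
and then `y`. -/
theorem exists_delete_palindrome (hr : 0 < r) (m l' : List X) : ∀ (l : List X) (x z : X)
    (α : RLoop p₀ r), α.points = l' ++ (l.reverse ++ x :: l) ++ m → (x :: l).getLast? = some z →
    ∃ β : RLoop p₀ r, β.points = l' ++ z :: m ∧ RHomotopic α β
  | [], x, z, α, h, hz => by
      simp only [List.getLast?_singleton, Option.some.injEq] at hz
      subst hz
      exact ⟨α, by simpa using h, Relation.ReflTransGen.refl⟩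
  | y :: l, x, z, α, h, hz => by
      obtain ⟨β, hβ, h1⟩ := exists_delete_middle hr α (l := l' ++ l.reverse) (m := l ++ m)
        (a := y) (b := x) (d := y) (by simp [h]) (by simpa using hr)
      obtain ⟨γ, hγ, h2⟩ := exists_delete_repetition hr β hβ
      obtain ⟨δ, hδ, h3⟩ := exists_delete_palindrome hr m l' l y z γ (by simp [hγ])
        (by simpa using hz)
      exact ⟨δ, hδ, (h1.trans h2).trans h3⟩

end RLoop

/-! ### The tautological cocycle with values in the coarse fundamental group -/

variable {p₀ : X}

/-- The homomorphism out of the coarse fundamental group given by a cocycle on edges. -/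
def CoarsePi1.lift (hr : 0 < r) (c : X → X → K) (hc : ∀ a, c a a = 1)
    (hsq : ∀ a b a' b', dist a b < r → dist a' b' < r → dist a a' < r → dist b b' < r →
      c a b * c b b' = c a a' * c a' b') : CoarsePi1 p₀ r hr →* K :=
  MonoidHom.mk' (fun x => Quotient.liftOn x (fun α : RLoop p₀ r => pathProd c α.points)
      (fun _ _ h => RLoop.pathProd_eq_of_homotopic hc hsq h))
    (by
      rintro ⟨α⟩ ⟨β⟩
      exact RLoop.pathProd_mul hr hc α β)

/-- The class of a loop in the coarse fundamental group. -/
def RLoop.toPi1 (hr : 0 < r) (α : RLoop p₀ r) : CoarsePi1 p₀ r hr := Quotient.mk _ α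

theorem RLoop.toPi1_mul (hr : 0 < r) (α β : RLoop p₀ r) :
    α.toPi1 hr * β.toPi1 hr = (mul hr α β).toPi1 hr := rfl

theorem RLoop.toPi1_eq {hr : 0 < r} {α β : RLoop p₀ r} (h : RHomotopic α β) :
    α.toPi1 hr = β.toPi1 hr := Quotient.sound h

/-- An `r`-path from `p₀` to `x`. -/
def IsRPathTo (p₀ : X) (r : ℝ) (x : X) (l : List X) : Prop :=
  l.IsChain (fun a b => dist a b < r) ∧ l.head? = some p₀ ∧ l.getLast? = some x

/-- The loop which runs to `x` along `l`, then along `w` and back along `m`. -/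
def RLoop.conj (hr : 0 < r) {x y : X} {l m w : List X} (hl : IsRPathTo p₀ r x l)
    (hm : IsRPathTo p₀ r y m) (hw : w.IsChain (fun a b => dist a b < r))
    (hwx : w.head? = some x) (hwy : w.getLast? = some y) : RLoop p₀ r :=
  RLoop.ofPoints (l ++ (w ++ m.reverse))
    (by
      have hm' : m.reverse.IsChain (fun a b => dist a b < r) := by
        rw [List.isChain_reverse]
        simpa only [dist_comm] using hm.1
      have hw0 : w ≠ [] := by rintro rfl; simp at hwx
      refine List.IsChain.append hl.1 (List.IsChain.append hw hm' ?_) ?_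
      · intro a ha b hb
        rw [List.head?_reverse, hm.2.2] at hb
        rw [hwy] at ha
        simp only [Option.mem_def, Option.some.injEq] at ha hb
        subst ha hb
        simpa using hr
      · intro a ha b hb
        rw [List.head?_append_of_ne_nil _ hw0, hwx] at hb
        rw [hl.2.2] at ha
        simp only [Option.mem_def, Option.some.injEq] at ha hb
        subst ha hb
        simpa using hr)
    (by
      obtain ⟨l', rfl⟩ := List.head?_eq_some_iff.1 hl.2.1
      rfl)
    (by
      obtain ⟨m', rfl⟩ := List.head?_eq_some_iff.1 hm.2.1
      simp)

/-- The cocycle on edges with values in the coarse fundamental group determined by a choice of base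
paths. -/
noncomputable def edgeClass (hr : 0 < r) {b : X → List X} (hb : ∀ x, IsRPathTo p₀ r x (b x))
    (x y : X) :
    CoarsePi1 p₀ r hr :=
  open Classical in
  if h : dist x y < r then
    (RLoop.conj hr (hb x) (hb y) (w := [x, y]) (by simpa using h) rfl rfl).toPi1 hr
  else 1

/-- The return along `m` and the departure along `m` form a palindrome. Cancelling it leaves three
consecutive copies of `y`, two of which are deleted. -/
theorem RLoop.conj_mul_conj (hr : 0 < r) {x y z : X} {l m n w v : List X}
    (hl : IsRPathTo p₀ r x l) (hm : IsRPathTo p₀ r y m) (hn : IsRPathTo p₀ r z n)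
    (hw : (w ++ [y]).IsChain (fun a b => dist a b < r)) (hwx : (w ++ [y]).head? = some x)
    (hv : (y :: v).IsChain (fun a b => dist a b < r)) (hvz : (y :: v).getLast? = some z) :
    ∃ β : RLoop p₀ r, β.points = l ++ (w ++ y :: v) ++ n.reverse ∧
      RHomotopic (mul hr (conj hr hl hm hw hwx (by simp)) (conj hr hm hn hv rfl hvz)) β := by
  obtain ⟨m', rfl⟩ := List.head?_eq_some_iff.1 hm.2.1
  obtain ⟨β, hβ, h1⟩ := exists_delete_repetition hr
    (mul hr (conj hr hl hm hw hwx (by simp)) (conj hr hm hn hv rfl hvz))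
    (l := l ++ (w ++ [y] ++ m'.reverse)) (a := p₀) (m := m' ++ (y :: v ++ n.reverse))
    (by simp [mul, conj, ofPoints])
  obtain ⟨γ, hγ, h2⟩ := exists_delete_palindrome hr (y :: v ++ n.reverse) (l ++ (w ++ [y])) m'
    p₀ y β (by simp [hβ]) hm.2.2
  obtain ⟨δ, hδ, h3⟩ := exists_delete_repetition hr γ (l := l ++ (w ++ [y])) (a := y)
    (m := v ++ n.reverse) (by simp [hγ])
  obtain ⟨ε, hε, h4⟩ := exists_delete_repetition hr δ (l := l ++ w) (a := y)
    (m := v ++ n.reverse) (by simp [hδ])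
  exact ⟨ε, by simp [hε], ((h1.trans h2).trans h3).trans h4⟩

theorem edgeClass_mul (hr : 0 < r) {b : X → List X} (hb : ∀ x, IsRPathTo p₀ r x (b x)) {x y z : X}
    (hxy : dist x y < r) (hyz : dist y z < r) (hxz : dist x z < r) :
    edgeClass hr hb x y * edgeClass hr hb y z = edgeClass hr hb x z := by
  simp only [edgeClass, hxy, hyz, hxz, dif_pos]
  rw [RLoop.toPi1_mul]
  obtain ⟨β, hβ, h⟩ := RLoop.conj_mul_conj hr (hb x) (hb y) (hb z) (w := [x]) (v := [z])
    (by simpa using hxy) rfl (by simpa using hyz) rfl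
  obtain ⟨γ, hγ, h'⟩ := RLoop.exists_delete_middle hr β (l := b x) (a := x) (b := y) (d := z)
    (m := (b z).reverse) (by simp [hβ]) hxz
  refine RLoop.toPi1_eq ((h.trans h').trans (RLoop.homotopic_of_points_eq ?_))
  simp [hγ, RLoop.conj, RLoop.ofPoints]

theorem pathProd_edgeClass (hr : 0 < r) {b : X → List X} (hb : ∀ x, IsRPathTo p₀ r x (b x))
    {z : X} : ∀ (w : List X) (x : X) (hw : (x :: w).IsChain (fun a b => dist a b < r))
      (hz : (x :: w).getLast? = some z),
      pathProd (edgeClass hr hb) (x :: w) = (RLoop.conj hr (hb x) (hb z) hw rfl hz).toPi1 hr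
  | [], x, hw, hz => by
      simp only [List.getLast?_singleton, Option.some.injEq] at hz
      subst hz
      rw [pathProd_singleton]
      obtain ⟨l, hl⟩ := List.getLast?_eq_some_iff.1 (hb x).2.2
      -- The turning point `x` occurs three times (end of the base path, `w`, start of the reversed
      -- path), hence the parameter `2` for `2 + 1` copies.
      refine (RLoop.toPi1_eq (hr := hr)
        (RLoop.palindrome_homotopic hr l x 2 _ (hl ▸ (hb x).1) (hl ▸ (hb x).2.1) ?_)).symm
      simp [RLoop.conj, RLoop.ofPoints, hl, List.replicate_succ]
  | y :: w, x, hw, hz => by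
      have hw' := List.isChain_cons_cons.1 hw
      rw [pathProd_cons_cons, pathProd_edgeClass hr hb w y hw'.2 (by simpa using hz), edgeClass,
        dif_pos hw'.1, RLoop.toPi1_mul]
      obtain ⟨β, hβ, h⟩ := RLoop.conj_mul_conj hr (hb x) (hb y) (hb z) (w := [x]) (v := w)
        (by simpa using hw'.1) rfl hw'.2 (by simpa using hz)
      refine RLoop.toPi1_eq (h.trans (RLoop.homotopic_of_points_eq ?_))
      simp [hβ, RLoop.conj, RLoop.ofPoints]

/-- The base path at `p₀` need not be constant, so the product is the class of `α` conjugated by the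
loop `b p₀`. -/
theorem eq_one_of_pathProd_edgeClass (hr : 0 < r) {b : X → List X}
    (hb : ∀ x, IsRPathTo p₀ r x (b x)) (α : RLoop p₀ r)
    (h : pathProd (edgeClass hr hb) α.points = 1) : α.toPi1 hr = 1 := by
  obtain ⟨l, hl⟩ := α.exists_points_eq_cons
  let β : RLoop p₀ r := RLoop.ofPoints (b p₀) (hb p₀).1 (hb p₀).2.1 (hb p₀).2.2
  have h1 := pathProd_edgeClass hr hb l p₀ (hl ▸ α.isRPath.2) (hl ▸ α.last_eq)
  have h2 : (RLoop.conj hr (hb p₀) (hb p₀) (hl ▸ α.isRPath.2) rfl (hl ▸ α.last_eq)).toPi1 hr =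
      β.toPi1 hr * (α.toPi1 hr * (β.toPi1 hr)⁻¹) := by
    refine congrArg (Quotient.mk _) (RLoop.ext ?_)
    simp [RLoop.conj, RLoop.ofPoints, RLoop.mul, RLoop.inv, β, hl]
  rw [hl] at h
  rw [h, h2] at h1
  have := h1.symm
  rw [← mul_assoc, mul_inv_eq_one, mul_eq_left] at this
  exact this

/-! ### Coarse regular covers and their deck groups -/

/-- A map `q : Y → X` which is a coarse regular covering at scale `r`, with deck group `G`: edges of
`X` lift to `Y`, lifts of squares close up, and `Y` is connected through edges. -/
structure IsCoarseRegularCover (X : Type*) {Y G : Type*} [PseudoMetricSpace X] [Group G]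
    [MulAction G Y] (r : ℝ) (q : Y → X) (Edge : Y → Y → Prop) : Prop where
  surjective : Function.Surjective q
  map_smul : ∀ (g : G) y, q (g • y) = q y
  exists_smul_eq : ∀ y y', q y = q y' → ∃ g : G, g • y = y'
  edge_smul : ∀ (g : G) y y', Edge y y' → Edge (g • y) (g • y')
  edge_refl : ∀ y, Edge y y
  dist_lt : ∀ y y', Edge y y' → dist (q y) (q y') < r
  exists_edge : ∀ y x, dist (q y) x < r → ∃ y', Edge y y' ∧ q y' = x
  -- Degenerate squares also give the uniqueness of lifted edges and the freeness of the action.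
  eq_one_of_square : ∀ y a b z (g : G), Edge y a → Edge a z → Edge y b → Edge b (g • z) → g = 1
  connected : ∀ y y', Relation.ReflTransGen Edge y y'

namespace IsCoarseRegularCover

variable {Y G : Type*} [Group G] [MulAction G Y] {q : Y → X} {Edge : Y → Y → Prop}

theorem exists_isRPathTo (h : IsCoarseRegularCover X (G := G) r q Edge) (p₀ x : X) :
    ∃ l, IsRPathTo p₀ r x l := by
  obtain ⟨y₀, rfl⟩ := h.surjective p₀
  obtain ⟨y, rfl⟩ := h.surjective x
  have hy := h.connected y₀ y
  induction hy with
  | refl => exact ⟨[q y₀], by simp, rfl, rfl⟩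
  | @tail b c _ hbc ih =>
    obtain ⟨l, h1, h2, h3⟩ := ih
    refine ⟨l ++ [q c], List.IsChain.append h1 (by simp) ?_, by simp [h2], by simp⟩
    intro u hu v hv
    rw [h3] at hu
    simp only [List.head?_cons, Option.mem_def, Option.some.injEq] at hu hv
    subst hu hv
    exact h.dist_lt _ _ hbc

theorem exists_deck_edge (h : IsCoarseRegularCover X (G := G) r q Edge) {s : X → Y}
    (hs : ∀ x, q (s x) = x) {x x' : X} (hx : dist x x' < r) : ∃ g : G, Edge (s x) (g • s x') := by
  obtain ⟨y', h1, h2⟩ := h.exists_edge (s x) x' (by rwa [hs])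
  obtain ⟨g, rfl⟩ := h.exists_smul_eq (s x') y' (by rw [hs, h2])
  exact ⟨g, h1⟩

open Classical in
/-- The deck transformation carrying the chosen point over `x'` next to the one over `x`. -/
noncomputable def deckCocycle (G : Type*) {Y : Type*} [Group G] [MulAction G Y]
    (Edge : Y → Y → Prop) (s : X → Y) (x x' : X) : G :=
  if h : ∃ g : G, Edge (s x) (g • s x') then h.choose else 1

theorem edge_deckCocycle (h : IsCoarseRegularCover X (G := G) r q Edge) {s : X → Y}
    (hs : ∀ x, q (s x) = x) {x x' : X} (hx : dist x x' < r) :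
    Edge (s x) (deckCocycle G Edge s x x' • s x') := by
  have := h.exists_deck_edge hs hx
  rw [deckCocycle, dif_pos this]
  exact this.choose_spec

theorem eq_of_square (h : IsCoarseRegularCover X (G := G) r q Edge) {y a b z : Y} {g g' : G}
    (h1 : Edge y a) (h2 : Edge a (g • z)) (h3 : Edge y b) (h4 : Edge b (g' • z)) : g = g' := by
  have := h.eq_one_of_square y a b (g • z) (g' * g⁻¹) h1 h2 h3 (by simpa [mul_smul] using h4)
  exact (mul_inv_eq_one.1 this).symm

theorem deckCocycle_eq (h : IsCoarseRegularCover X (G := G) r q Edge) {s : X → Y}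
    (hs : ∀ x, q (s x) = x) {x x' : X} {g g' : G} (he : Edge (g • s x) (g' • s x')) :
    deckCocycle G Edge s x x' = g⁻¹ * g' := by
  have he' := h.edge_smul g⁻¹ _ _ he
  rw [inv_smul_smul, ← mul_smul] at he'
  have hd := h.dist_lt _ _ he'
  rw [h.map_smul, hs, hs] at hd
  exact h.eq_of_square (h.edge_refl _) (h.edge_deckCocycle hs hd) (h.edge_refl _) he'

/-- Each side records where one half of the square, lifted from `s a`, ends in the fibre over `b'`;
the two lifts end at the same point. -/
theorem deckCocycle_square (h : IsCoarseRegularCover X (G := G) r q Edge) {s : X → Y}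
    (hs : ∀ x, q (s x) = x) {a b a' b' : X} (h1 : dist a b < r) (h2 : dist a' b' < r)
    (h3 : dist a a' < r) (h4 : dist b b' < r) :
    deckCocycle G Edge s a b * deckCocycle G Edge s b b' =
      deckCocycle G Edge s a a' * deckCocycle G Edge s a' b' := by
  have key : ∀ u v w : X, dist v w < r →
      Edge (deckCocycle G Edge s u v • s v)
        ((deckCocycle G Edge s u v * deckCocycle G Edge s v w) • s w) := by
    intro u v w hvw
    rw [mul_smul]
    exact h.edge_smul _ _ _ (h.edge_deckCocycle hs hvw)
  exact h.eq_of_square (h.edge_deckCocycle hs h1) (key a b b' h4) (h.edge_deckCocycle hs h3)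
    (key a a' b' h2)

/-- A deck transformation moves the fibres along discrete paths, and any coboundary is
evaluated at the end of the lifted path. -/
theorem exists_lift_path (h : IsCoarseRegularCover X (G := G) r q Edge) {s : X → Y}
    (hs : ∀ x, q (s x) = x) {c : X → X → K} {F : Y → K}
    (hF : ∀ y y', Edge y y' → c (q y) (q y') = (F y)⁻¹ * F y') {z : X} :
    ∀ (w : List X) (x : X) (g : G), (x :: w).IsChain (fun a b => dist a b < r) →
      (x :: w).getLast? = some z → ∃ g' : G,
        pathProd (deckCocycle G Edge s) (x :: w) = g⁻¹ * g' ∧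
        pathProd c (x :: w) = (F (g • s x))⁻¹ * F (g' • s z)
  | [], x, g, _, hz => by
      simp only [List.getLast?_singleton, Option.some.injEq] at hz
      subst hz
      exact ⟨g, by simp, by simp⟩
  | x' :: w, x, g, hw, hz => by
      obtain ⟨h1, h2⟩ := List.isChain_cons_cons.1 hw
      have he := h.edge_smul g _ _ (h.edge_deckCocycle hs h1)
      rw [← mul_smul] at he
      obtain ⟨g', hg1, hg2⟩ := exists_lift_path h hs hF w x'
        (g * deckCocycle G Edge s x x') h2 (by simpa using hz)
      refine ⟨g', ?_, ?_⟩
      · rw [pathProd_cons_cons, hg1]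
        group
      · have := hF _ _ he
        rw [h.map_smul, h.map_smul, hs, hs] at this
        rw [pathProd_cons_cons, hg2, this]
        group

/-- Projecting an edge path realizes its endpoint by the deck product of a path downstairs; this is
the source of surjectivity. -/
theorem exists_path_of_edges (h : IsCoarseRegularCover X (G := G) r q Edge) {s : X → Y}
    (hs : ∀ x, q (s x) = x) {x₀ : X} {y : Y} (hy : Relation.ReflTransGen Edge (s x₀) y) :
    ∃ (w : List X) (g : G), IsRPathTo x₀ r (q y) (x₀ :: w) ∧ g • s (q y) = y ∧
      pathProd (deckCocycle G Edge s) (x₀ :: w) = g := by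
  induction hy with
  | refl =>
    rw [hs]
    exact ⟨[], 1, ⟨by simp, rfl, rfl⟩, by simp, by simp⟩
  | @tail b d _ hbd ih =>
    obtain ⟨w, g, ⟨h1, -, h3⟩, hg, hp⟩ := ih
    obtain ⟨g', hg'⟩ := h.exists_smul_eq (s (q d)) d (hs _)
    refine ⟨w ++ [q d], g', ⟨?_, rfl, by rw [← List.cons_append, List.getLast?_concat]⟩, hg', ?_⟩
    · rw [← List.cons_append]
      refine List.IsChain.append h1 (by simp) ?_
      intro u hu v hv
      rw [h3] at hu
      simp only [List.head?_cons, Option.mem_def, Option.some.injEq] at hu hv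
      subst hu hv
      exact h.dist_lt _ _ hbd
    · obtain ⟨l, hl⟩ := List.getLast?_eq_some_iff.1 h3
      have e : x₀ :: (w ++ [q d]) = l ++ q b :: [q d] := by
        rw [← List.cons_append, hl]; simp
      rw [e, pathProd_append, ← hl, hp, pathProd_cons_cons, pathProd_singleton, mul_one,
        h.deckCocycle_eq hs (g := g) (g' := g') (by rwa [hg, hg'])]
      group

/-- A coarse regular cover on which all cocycles of the base become coboundaries computes the coarse
fundamental group. -/
theorem nonempty_mulEquiv (hr : 0 < r) (h : IsCoarseRegularCover X (G := G) r q Edge) (p₀ : X)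
    (hF : ∀ c : X → X → CoarsePi1 p₀ r hr,
      (∀ x y z, dist x y < r → dist y z < r → dist x z < r → c x y * c y z = c x z) →
      ∃ F : Y → CoarsePi1 p₀ r hr, ∀ y y', Edge y y' → c (q y) (q y') = (F y)⁻¹ * F y') :
    Nonempty (CoarsePi1 p₀ r hr ≃* G) := by
  choose s hs using h.surjective
  choose b hb using h.exists_isRPathTo p₀
  have h1 : ∀ x, deckCocycle G Edge s x x = 1 := by
    intro x
    rw [h.deckCocycle_eq hs (g := 1) (g' := 1) (by simpa using h.edge_refl (s x))]
    simp
  let Φ : CoarsePi1 p₀ r hr →* G := CoarsePi1.lift hr (deckCocycle G Edge s) h1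
    (fun a b a' b' => h.deckCocycle_square hs)
  -- Triviality of the tautological cocycle upstairs is what yields injectivity.
  obtain ⟨F, hF⟩ := hF (edgeClass hr hb) (fun x y z => edgeClass_mul hr hb)
  refine ⟨MulEquiv.ofBijective Φ ⟨(injective_iff_map_eq_one Φ).2 ?_, ?_⟩⟩
  · rintro ⟨α⟩ hα
    change pathProd (deckCocycle G Edge s) α.points = 1 at hα
    refine eq_one_of_pathProd_edgeClass hr hb α ?_
    obtain ⟨l, hl⟩ := α.exists_points_eq_cons
    obtain ⟨g, hg1, hg2⟩ := h.exists_lift_path hs hF l p₀ 1 (hl ▸ α.isRPath.2) (hl ▸ α.last_eq)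
    rw [hl] at hα ⊢
    rw [hα] at hg1
    -- The lift of `α` closes up, so the telescoping product of values of `F` is trivial.
    have : g = 1 := by simpa using hg1.symm
    rw [hg2, this, inv_mul_cancel]
  · intro g
    obtain ⟨w, g', hw, hg, hp⟩ := h.exists_path_of_edges hs (h.connected (s p₀) (g • s p₀))
    rw [h.map_smul, hs] at hg hw
    have hgg : g' = g := by
      refine h.eq_of_square (z := s p₀) (h.edge_refl _) (h.edge_refl _) (h.edge_refl _) ?_
      rw [hg]
      exact h.edge_refl _
    exact ⟨(RLoop.ofPoints (p₀ :: w) hw.1 rfl hw.2.2).toPi1 hr, hp.trans hgg⟩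

end IsCoarseRegularCover

end CoarseCocycles

/-! ### Finitely presented groups at large scale -/

namespace FiniteSymmGenSet

variable {Γ : Type*} [Group Γ] (S : FiniteSymmGenSet Γ)

theorem wordLength_le_one {s : Γ} (hs : s ∈ S.carrier) : S.wordLength s ≤ 1 := by
  simpa using S.wordLength_le (l := [s]) (by simpa using hs)

theorem wordLength_inv (a : Γ) : S.wordLength a⁻¹ = S.wordLength a :=
  le_antisymm (S.wordLength_inv_le a) (by simpa using S.wordLength_inv_le a⁻¹)

theorem finite_setOf_wordLength_le (n : ℕ) : {γ : Γ | S.wordLength γ ≤ n}.Finite := by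
  have := S.finite.to_subtype
  refine ((List.finite_length_le S.carrier n).image
    (fun l => (l.map Subtype.val).prod)).subset ?_
  intro γ hγ
  obtain ⟨l, hl, hp, hn⟩ := S.exists_word_length γ
  refine ⟨l.attach.map (fun x => ⟨x.1, hl x.1 x.2⟩), ?_, ?_⟩
  · simp only [Set.mem_ofPred_eq, List.length_map, List.length_attach]
    exact hn.trans_le hγ
  · simp only [List.map_map, Function.comp_def]
    rw [← hp]
    congr 1
    exact List.attach_map_subtype_val l

/-- A cocycle on pairs of group elements at distance `< r`. -/
def IsCocycle {K : Type*} [Group K] (r : ℝ) (f : Γ → Γ → K) : Prop :=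
  ∀ a b c, (S.wordDist a b : ℝ) < r → (S.wordDist b c : ℝ) < r → (S.wordDist a c : ℝ) < r →
    f a b * f b c = f a c

end FiniteSymmGenSet

section Transport

variable {Γ K α : Type*} [Group Γ] [Group K]

/-- The permutation of `Γ × K` which multiplies on the right by the inverse of `a` in the first
factor and transports along `f` in the second. -/
def transportPerm (f : Γ → Γ → K) (hf : ∀ a b, f a b * f b a = 1) (a : Γ) :
    Equiv.Perm (Γ × K) where
  toFun x := (x.1 * a⁻¹, x.2 * f x.1 (x.1 * a⁻¹))
  invFun x := (x.1 * a, x.2 * f x.1 (x.1 * a))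
  left_inv x := by
    ext
    · simp
    · simp [mul_assoc, hf]
  right_inv x := by
    ext
    · simp
    · simp [mul_assoc, hf]

/-- The action of a free group on `Γ × K` by transport along `f`. -/
def transportHom (f : Γ → Γ → K) (hf : ∀ a b, f a b * f b a = 1) (φ : FreeGroup α →* Γ) :
    FreeGroup α →* Equiv.Perm (Γ × K) :=
  FreeGroup.lift fun i => transportPerm f hf (φ (FreeGroup.of i))

theorem transportHom_letter (f : Γ → Γ → K) (hf : ∀ a b, f a b * f b a = 1)
    (φ : FreeGroup α →* Γ) (i : α) (b : Bool) (x : Γ × K) :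
    transportHom f hf φ (FreeGroup.mk [(i, b)]) x =
      (x.1 * (φ (FreeGroup.mk [(i, b)]))⁻¹, x.2 * f x.1 (x.1 * (φ (FreeGroup.mk [(i, b)]))⁻¹)) := by
  cases b
  · have e : (FreeGroup.mk [(i, false)] : FreeGroup α) = (FreeGroup.of i)⁻¹ := rfl
    rw [e, map_inv, map_inv, inv_inv, transportHom, FreeGroup.lift_apply_of]
    rfl
  · have e : (FreeGroup.mk [(i, true)] : FreeGroup α) = FreeGroup.of i := rfl
    rw [e, transportHom, FreeGroup.lift_apply_of]
    rfl

theorem transportHom_fst (f : Γ → Γ → K) (hf : ∀ a b, f a b * f b a = 1)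
    (φ : FreeGroup α →* Γ) : ∀ (L : List (α × Bool)) (x : Γ × K),
    (transportHom f hf φ (FreeGroup.mk L) x).1 = x.1 * (φ (FreeGroup.mk L))⁻¹
  | [], x => by
      have e : (FreeGroup.mk [] : FreeGroup α) = 1 := rfl
      simp [e]
  | (i, b) :: L, x => by
      have e : (FreeGroup.mk ((i, b) :: L) : FreeGroup α) =
        FreeGroup.mk [(i, b)] * FreeGroup.mk L := by rw [FreeGroup.mul_mk]; rfl
      rw [e, map_mul, Equiv.Perm.mul_apply, transportHom_letter, transportHom_fst f hf φ L x,
        map_mul, mul_inv_rev, mul_assoc]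

/-- Letters act from the right end of the word. Each new letter gives a triangle whose sides are a
suffix, the letter and the longer suffix, all short enough for the cocycle relation. -/
theorem transportHom_apply (S : FiniteSymmGenSet Γ) {r : ℝ} {f : Γ → Γ → K}
    (hf : ∀ a b, f a b * f b a = 1) (hc : S.IsCocycle r f) (φ : FreeGroup α →* Γ)
    (hφ : ∀ i b, (S.wordLength (φ (FreeGroup.mk [(i, b)])) : ℝ) < r) :
    ∀ (L : List (α × Bool)) (_ : ∀ L', L' <:+ L → (S.wordLength (φ (FreeGroup.mk L')) : ℝ) < r)
      (x : Γ × K), transportHom f hf φ (FreeGroup.mk L) x =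
        (x.1 * (φ (FreeGroup.mk L))⁻¹, x.2 * f x.1 (x.1 * (φ (FreeGroup.mk L))⁻¹))
  | [], _, x => by
      have e : (FreeGroup.mk [] : FreeGroup α) = 1 := rfl
      have h0 : (0 : ℝ) < r := by
        have := (‹∀ L', L' <:+ [] → (S.wordLength (φ (FreeGroup.mk L')) : ℝ) < r›) [] List.suffix_rfl
        simpa [e, S.wordLength_one] using this
      have h1 := hc x.1 x.1 x.1
      simp only [S.wordDist_self, Nat.cast_zero, h0, true_implies, mul_eq_left] at h1
      simp [e, h1]
  | (i, b) :: L, hL, x => by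
      have e : (FreeGroup.mk ((i, b) :: L) : FreeGroup α) =
        FreeGroup.mk [(i, b)] * FreeGroup.mk L := by rw [FreeGroup.mul_mk]; rfl
      have h2 := hL _ List.suffix_rfl
      have h1 := hL L (List.suffix_cons _ _)
      have h3 := hφ i b
      have ih := transportHom_apply S hf hc φ hφ L
        (fun L' h' => hL L' (h'.trans (List.suffix_cons _ _))) x
      rw [e, map_mul] at h2
      rw [e, map_mul, Equiv.Perm.mul_apply, ih, transportHom_letter, map_mul, mul_inv_rev,
        mul_assoc]
      refine Prod.ext (by simp) ?_
      dsimp only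
      rw [mul_assoc, hc]
      · simpa [FiniteSymmGenSet.wordDist, S.wordLength_inv] using h1
      · simpa [FiniteSymmGenSet.wordDist, S.wordLength_inv, mul_assoc] using h3
      · rw [FiniteSymmGenSet.wordDist, inv_mul_cancel_left, ← mul_inv_rev,
          S.wordLength_inv]
        exact h2

end Transport

namespace FiniteSymmGenSet

variable {Γ : Type*} [Group Γ] (S : FiniteSymmGenSet Γ)

/-- Walk along a shortest word from `a` to `b`: all its prefixes have length below `r`, so every
triangle on the way is admissible. -/
theorem IsCocycle.eq_of_generators {K : Type*} [Group K] {S : FiniteSymmGenSet Γ} {r : ℝ}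
    (hr : 1 < r) {f : Γ → Γ → K} (hf : S.IsCocycle r f) {h : Γ → K}
    (hh : ∀ a, ∀ s ∈ S.carrier, f a (a * s) = (h a)⁻¹ * h (a * s)) (a b : Γ)
    (hab : (S.wordDist a b : ℝ) < r) : f a b = (h a)⁻¹ * h b := by
  have key : ∀ l : List Γ, (∀ s ∈ l, s ∈ S.carrier) → (l.length : ℝ) < r →
      f a (a * l.prod) = (h a)⁻¹ * h (a * l.prod) := by
    intro l
    induction l using List.reverseRecOn with
    | nil =>
      intro _ _
      have h1 := hf a a a
      simp only [S.wordDist_self, Nat.cast_zero, zero_lt_one.trans hr, true_implies,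
        mul_eq_left] at h1
      simp [h1]
    | append_singleton l s ih =>
      intro hl hlen
      have hl' : ∀ x ∈ l, x ∈ S.carrier := fun x hx => hl x (by simp [hx])
      have hs : s ∈ S.carrier := hl s (by simp)
      have h1 : (S.wordLength l.prod : ℝ) ≤ l.length := by exact_mod_cast S.wordLength_le hl'
      have h2 : (S.wordLength (l ++ [s]).prod : ℝ) ≤ (l ++ [s]).length := by
        exact_mod_cast S.wordLength_le hl
      have h3 : (S.wordLength s : ℝ) ≤ 1 := by exact_mod_cast S.wordLength_le_one hs
      have h4 : (l.length : ℝ) < r := by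
        rw [List.length_append] at hlen
        push_cast at hlen
        have : (0 : ℝ) ≤ ([s] : List Γ).length := Nat.cast_nonneg _
        linarith
      have e : a * (l ++ [s]).prod = a * l.prod * s := by simp [mul_assoc]
      rw [← hf a (a * l.prod) (a * (l ++ [s]).prod), ih hl' h4, e, hh _ s hs]
      · group
      · simpa [wordDist] using h1.trans_lt h4
      · rw [e]
        rw [wordDist, inv_mul_cancel_left]
        exact h3.trans_lt hr
      · simp only [wordDist, inv_mul_cancel_left]
        exact h2.trans_lt hlen
  obtain ⟨l, hl, hp, hn⟩ := S.exists_word_length (a⁻¹ * b)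
  have := key l hl (by rw [hn]; exact hab)
  rwa [hp, mul_inv_cancel_left] at this

universe v in
open Classical in
/-- Cocycles at a large scale on a finitely presented group are coboundaries. -/
theorem exists_scale_isCocycle_trivial [Group.IsFinitelyPresented Γ] :
    ∃ B : ℝ, ∀ r : ℝ, B < r → ∀ {K : Type v} [Group K] (f : Γ → Γ → K), S.IsCocycle r f →
      ∃ h : Γ → K, ∀ a b, (S.wordDist a b : ℝ) < r → f a b = (h a)⁻¹ * h b := by
  obtain ⟨n, φ, hφ, R, hR, hRφ⟩ := Group.IsFinitelyPresented.out (G := Γ)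
  choose σ hσ using hφ
  -- The words along which transport must be computed: relators, chosen lifts of the generators in
  -- `S`, and single letters. The bound `B` controls the images of all their suffixes.
  let T : Set (FreeGroup (Fin n)) :=
    R ∪ σ '' S.carrier ∪ Set.range (fun x : Fin n × Bool => FreeGroup.mk [x])
  have hT : T.Finite := (hR.union (S.finite.image σ)).union (Set.finite_range _)
  have hU : (⋃ w ∈ T, (fun L => (S.wordLength (φ (FreeGroup.mk L)) : ℝ)) ''
      {L | L ∈ w.toWord.tails}).Finite :=
    hT.biUnion fun w _ => (List.finite_toSet w.toWord.tails).image _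
  obtain ⟨B, hB⟩ := hU.bddAbove
  have hB' : ∀ w ∈ T, ∀ L, L <:+ w.toWord → (S.wordLength (φ (FreeGroup.mk L)) : ℝ) ≤ B := by
    intro w hw L hL
    exact hB (Set.mem_biUnion hw ⟨L, (List.mem_tails _ _).2 hL, rfl⟩)
  refine ⟨max B 1, fun r hr K _ f₀ hf₀ => ?_⟩
  have hr1 : 1 < r := (le_max_right _ _).trans_lt hr
  have hrB : B < r := (le_max_left _ _).trans_lt hr
  -- Setting the value to `1` at distances at least `r` makes `f a b * f b a = 1` hold for all
  -- pairs, as `transportPerm` requires.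
  let f : Γ → Γ → K := fun a b => if (S.wordDist a b : ℝ) < r then f₀ a b else 1
  have hc : S.IsCocycle r f := by
    intro a b c h1 h2 h3
    simp only [f, h1, h2, h3, if_true]
    exact hf₀ a b c h1 h2 h3
  have h0 : ∀ a, f a a = 1 := by
    intro a
    have h1 := hc a a a
    simpa only [S.wordDist_self, Nat.cast_zero, zero_lt_one.trans hr1, true_implies,
      mul_eq_left] using h1
  have hf : ∀ a b, f a b * f b a = 1 := by
    intro a b
    by_cases h : (S.wordDist a b : ℝ) < r
    · rw [hc a b a h (by rwa [S.wordDist_comm]) (by simp [S.wordDist_self]; linarith), h0]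
    · simp [f, h, S.wordDist_comm b a]
  have hletter : ∀ i b, (S.wordLength (φ (FreeGroup.mk [(i, b)])) : ℝ) < r := by
    intro i b
    have := hB' (FreeGroup.mk [(i, b)]) (Or.inr ⟨(i, b), rfl⟩) [(i, b)] (by
      simp [FreeGroup.toWord_mk])
    linarith
  have happly : ∀ w ∈ T, ∀ x, transportHom f hf φ w x =
      (x.1 * (φ w)⁻¹, x.2 * f x.1 (x.1 * (φ w)⁻¹)) := by
    intro w hw x
    have := transportHom_apply S hf hc φ hletter w.toWord
      (fun L hL => (hB' w hw L hL).trans_lt hrB) x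
    rwa [FreeGroup.mk_toWord] at this
  -- Relators return to their starting point with transport `f a a = 1`, so the action factors
  -- through `Γ`.
  have hker : φ.ker ≤ (transportHom f hf φ).ker := by
    rw [← hRφ]
    refine Subgroup.normalClosure_le_normal fun w hw => ?_
    have hw1 : φ w = 1 := by
      have : w ∈ φ.ker := hRφ ▸ Subgroup.subset_normalClosure hw
      exact this
    refine Equiv.ext fun x => ?_
    rw [happly w (Or.inl (Or.inl hw)), hw1]
    simp [h0]
  have hcongr : ∀ v w, φ v = φ w → transportHom f hf φ v = transportHom f hf φ w := by
    intro v w hvw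
    have : v * w⁻¹ ∈ φ.ker := by rw [MonoidHom.mem_ker, map_mul, map_inv, hvw, mul_inv_cancel]
    have := hker this
    rwa [MonoidHom.mem_ker, map_mul, map_inv, mul_inv_eq_one] at this
  -- The primitive is transport from `1` to `a`; the inverse appears because letters act by right
  -- multiplication by inverses.
  let h : Γ → K := fun a => (transportHom f hf φ (σ a⁻¹) (1, 1)).2
  have hh : ∀ a, transportHom f hf φ (σ a⁻¹) (1, 1) = (a, h a) := by
    intro a
    refine Prod.ext ?_ rfl
    have := transportHom_fst f hf φ (σ a⁻¹).toWord (1, 1)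
    rw [FreeGroup.mk_toWord, hσ] at this
    simpa using this
  have hgen : ∀ a, ∀ s ∈ S.carrier, f a (a * s) = (h a)⁻¹ * h (a * s) := by
    intro a s hs
    have h1 := happly (σ s⁻¹) (Or.inl (Or.inr ⟨s⁻¹, S.inv_mem s hs, rfl⟩)) (a, h a)
    rw [← hh a, ← Equiv.Perm.mul_apply, ← map_mul, hcongr _ (σ (a * s)⁻¹) (by simp [hσ]), hh,
      hh] at h1
    have h2 := congrArg Prod.snd h1
    simp only [hσ, inv_inv] at h2
    rw [h2]
    group
  refine ⟨h, fun a b hab => ?_⟩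
  rw [← hc.eq_of_generators hr1 hgen a b hab]
  simp [f, hab]

end FiniteSymmGenSet

/-! ### Locally defined cocycles on simply connected spaces -/

section CocycleCover

open Topology

/-- The product `E × K`, to be topologized by letting `f` be the transition of the leaves. -/
@[ext]
structure CocycleCover {E K : Type*} (f : E → E → K) where
  fst : E
  snd : K

variable {E K : Type*} [TopologicalSpace E] [Group K]

namespace CocycleCover

variable {f : E → E → K}

instance : TopologicalSpace (CocycleCover f) where
  IsOpen W := ∀ x ∈ W, ∀ᶠ e in 𝓝 x.1, (⟨e, x.2 * f x.1 e⟩ : CocycleCover f) ∈ W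
  isOpen_univ := fun _ _ => Filter.Eventually.of_forall fun _ => trivial
  isOpen_inter := fun _ _ h h' x hx => (h x hx.1).and (h' x hx.2)
  isOpen_sUnion := fun _ h x ⟨W, hW, hx⟩ => (h W hW x hx).mono fun _ he => ⟨W, hW, he⟩

theorem isOpen_iff {W : Set (CocycleCover f)} : IsOpen W ↔
    ∀ x ∈ W, ∀ᶠ e in 𝓝 x.1, (⟨e, x.2 * f x.1 e⟩ : CocycleCover f) ∈ W := Iff.rfl

/-- The projection to the base. -/
def proj (f : E → E → K) (x : CocycleCover f) : E := x.1

variable {U : Set E}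

theorem isOpen_leaf (hU : IsOpen U) (hf : ∀ a ∈ U, ∀ b ∈ U, ∀ c ∈ U, f a b * f b c = f a c) {a : E}
    (ha : a ∈ U) (k : K) : IsOpen {x : CocycleCover f | x.1 ∈ U ∧ x.2 = k * f a x.1} := by
  rw [isOpen_iff]
  rintro ⟨e, u⟩ ⟨he, rfl : u = k * f a e⟩
  filter_upwards [hU.mem_nhds he] with e' he'
  refine ⟨he', ?_⟩
  rw [mul_assoc, hf a ha e he e' he']

theorem continuous_proj : Continuous (proj f) := by
  refine continuous_def.2 fun U hU => isOpen_iff.2 fun x hx => ?_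
  filter_upwards [hU.mem_nhds hx] with e he using he

theorem continuousOn_leaf
    (hf : ∀ a ∈ U, ∀ b ∈ U, ∀ c ∈ U, f a b * f b c = f a c) {a : E}
    (ha : a ∈ U) (k : K) : Continuous fun e : U => (⟨e, k * f a e⟩ : CocycleCover f) := by
  refine continuous_def.2 fun W hW => isOpen_iff_mem_nhds.2 fun e he => ?_
  have h1 := isOpen_iff.1 hW _ he
  have h2 : ∀ᶠ e' : U in 𝓝 e, (⟨e'.1, k * f a e * f e e'⟩ : CocycleCover f) ∈ W :=
    continuous_subtype_val.continuousAt.eventually h1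
  filter_upwards [h2] with e' he'
  rw [mul_assoc, hf a ha e e.2 e' e'.2] at he'
  exact he'

theorem eq_one (hf : ∀ a ∈ U, ∀ b ∈ U, ∀ c ∈ U, f a b * f b c = f a c) {a : E} (ha : a ∈ U) :
    f a a = 1 := by
  have := hf a ha a ha a ha
  rwa [mul_eq_left] at this

/-- Over a set where the cocycle relation holds, transporting the second coordinate to the centre
`a` makes the leaves constant, which gives a trivialization. -/
theorem isCoveringMap_proj
    (hf : ∀ e, ∃ U : Set E, IsOpen U ∧ e ∈ U ∧ ∀ a ∈ U, ∀ b ∈ U, ∀ c ∈ U, f a b * f b c = f a c) :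
    IsCoveringMap (proj f) := by
  let _ : TopologicalSpace K := ⊥
  have : DiscreteTopology K := ⟨rfl⟩
  intro a
  obtain ⟨U, hU, ha, hUf⟩ := hf a
  suffices IsEvenlyCovered (proj f) a K from this.to_isEvenlyCovered_preimage
  have hinv : ∀ e ∈ U, f e a * f a e = 1 := fun e he => by
    rw [hUf e he a ha e he, eq_one hUf he]
  have hinv' : ∀ e ∈ U, f a e * f e a = 1 := fun e he => by
    rw [hUf a ha e he a ha, eq_one hUf ha]
  have hpre : IsOpen (proj f ⁻¹' U) := hU.preimage continuous_proj
  refine ⟨inferInstance, U, ha, hU, hpre,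
    { toFun := fun x => (⟨x.1.1, x.2⟩, x.1.2 * f x.1.1 a)
      invFun := fun x => ⟨(⟨x.1.1, x.2 * f a x.1⟩ : CocycleCover f), x.1.2⟩
      left_inv := fun x => ?_
      right_inv := fun x => ?_
      continuous_toFun := ?_
      continuous_invFun := ?_ }, fun x => rfl⟩
  · refine Subtype.ext (CocycleCover.ext rfl ?_)
    change x.1.2 * f x.1.1 a * f a x.1.1 = x.1.2
    rw [mul_assoc, hinv x.1.1 x.2, mul_one]
  · refine Prod.ext rfl ?_
    change x.2 * f a x.1 * f x.1 a = x.2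
    rw [mul_assoc, hinv' _ x.1.2, mul_one]
  · refine Continuous.prodMk (Continuous.subtype_mk (continuous_proj.comp continuous_subtype_val) _)
      (continuous_discrete_rng.2 fun k => ?_)
    convert (isOpen_leaf hU hUf ha k).preimage continuous_subtype_val using 1
    ext x
    have hx : x.1.1 ∈ U := x.2
    simp only [Set.mem_preimage, Set.mem_singleton_iff, Set.mem_ofPred_eq, hx, true_and]
    constructor
    · rintro rfl
      rw [mul_assoc, hinv _ hx, mul_one]
    · intro h
      rw [h, mul_assoc, hinv' _ hx, mul_one]
  · refine Continuous.subtype_mk ?_ _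
    refine continuous_prod_of_discrete_right.2 ?_
    exact fun k => continuousOn_leaf hUf ha k

end CocycleCover

/-- The identity of `E` lifts to a section of the covering with fibre `K`. Its second coordinate is
the primitive, since near each point the section stays in one leaf. -/
theorem exists_locally_coboundary [SimplyConnectedSpace E] [LocallyPathConnectedSpace E]
    {f : E → E → K}
    (hf : ∀ e, ∃ U : Set E, IsOpen U ∧ e ∈ U ∧ ∀ a ∈ U, ∀ b ∈ U, ∀ c ∈ U, f a b * f b c = f a c) :
    ∃ h : E → K, ∀ e, ∃ U : Set E, IsOpen U ∧ e ∈ U ∧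
      ∀ a ∈ U, ∀ b ∈ U, f a b = (h a)⁻¹ * h b := by
  obtain ⟨a₀⟩ : Nonempty E := inferInstance
  obtain ⟨F, ⟨-, hF⟩, -⟩ :=
    (CocycleCover.isCoveringMap_proj hf).existsUnique_continuousMap_lifts (ContinuousMap.id E) a₀
      (⟨a₀, 1⟩ : CocycleCover f) rfl
  have hF1 : ∀ e, (F e).1 = e := fun e => congrFun hF e
  refine ⟨fun e => (F e).2, fun e => ?_⟩
  obtain ⟨U, hU, he, hUf⟩ := hf e
  refine ⟨U ∩ F ⁻¹' {x | x.1 ∈ U ∧ x.2 = (F e).2 * f e x.1},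
    hU.inter ((CocycleCover.isOpen_leaf hU hUf he _).preimage F.continuous), ⟨he, ?_, ?_⟩, ?_⟩
  · rw [hF1]; exact he
  · rw [hF1, CocycleCover.eq_one hUf he, mul_one]
  · rintro a ⟨ha, -, ha'⟩ b ⟨hb, -, hb'⟩
    rw [hF1] at ha' hb'
    change f a b = (F a).2⁻¹ * (F b).2
    rw [ha', hb', ← hUf e he a ha b hb]
    group

/-- The function `x ↦ f a x * (h x)⁻¹` is locally constant on `C`. -/
theorem eq_coboundary_of_isPreconnected {f : E → E → K} {h : E → K} {C : Set E}
    (hC : IsPreconnected C) {a : E} (ha : a ∈ C) (haa : f a a = 1)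
    (hf : ∀ b ∈ C, ∀ᶠ b' in 𝓝[C] b, f a b * f b b' = f a b' ∧ f b b' = (h b)⁻¹ * h b')
    {b : E} (hb : b ∈ C) : f a b = (h a)⁻¹ * h b := by
  have := hC.induction₂ (fun x y => f a x * (h x)⁻¹ = f a y * (h y)⁻¹)
    (fun x hx => (hf x hx).mono fun y hy => by
      rw [← hy.1, hy.2]
      group)
    (fun _ _ _ _ _ _ h1 h2 => h1.trans h2) (fun _ _ _ _ h1 => h1.symm) ha hb
  rw [haa, one_mul] at this
  rw [this]
  group

end CocycleCover

/-! ### Sheets of covering maps -/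

section Sheets

open Topology

theorem IsLocalHomeomorph.locallyPathConnectedSpace {E X : Type*} [TopologicalSpace E]
    [TopologicalSpace X] [LocallyPathConnectedSpace X] {p : E → X} (hp : IsLocalHomeomorph p) :
    LocallyPathConnectedSpace E := by
  rw [locallyPathConnectedSpace_iff_pathComponentIn_mem_nhds]
  intro x u hu hx
  obtain ⟨φ, hφ, rfl⟩ := hp x
  have hopen : IsOpen (φ.target ∩ φ.symm ⁻¹' u) := φ.isOpen_inter_preimage_symm hu
  obtain ⟨V, ⟨hV, hVc⟩, hVs⟩ := (path_connected_basis (φ x)).mem_iff.1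
    (hopen.mem_nhds ⟨φ.map_source hφ, by simpa [φ.left_inv hφ] using hx⟩)
  have hpc : IsPathConnected (φ.symm '' V) :=
    hVc.image' (φ.continuousOn_symm.mono fun y hy => (hVs hy).1)
  have hsub : φ.symm '' V ⊆ pathComponentIn u x := by
    refine hpc.subset_pathComponentIn ⟨φ x, mem_of_mem_nhds hV, φ.left_inv hφ⟩ ?_
    rintro _ ⟨y, hy, rfl⟩
    exact (hVs hy).2
  filter_upwards [φ.open_source.mem_nhds hφ, φ.continuousAt hφ hV] with y hy hy'
  exact hsub ⟨φ y, hy', φ.left_inv hy⟩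

variable {E M : Type*} [TopologicalSpace E] [MetricSpace M] {p : E → M}

/-- Take a Lebesgue number of a cover by evenly covered sets. The fibre coordinate is constant on a
connected set over a small ball, and the sheet over such a ball through `e` is connected because the
ball is. -/
theorem IsCoveringMap.exists_sheets [CompactSpace M] (hp : IsCoveringMap p)
    (hball : ∀ (x : M) (ρ : ℝ), IsPreconnected (Metric.ball x ρ)) :
    ∃ ε > 0, (∀ (C : Set E) (x : M) (e e' : E), IsPreconnected C → e ∈ C → e' ∈ C →
        p '' C ⊆ Metric.ball x ε → p e = p e' → e = e') ∧
      ∀ (e : E) (x : M) (ρ : ℝ), ρ ≤ ε → dist (p e) x < ρ → ∃ C : Set E, IsPreconnected C ∧ e ∈ C ∧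
        p '' C ⊆ Metric.ball (p e) ρ ∧ ∃ e' ∈ C, p e' = x := by
  choose hdisc U hU hUo hUp H hH using hp
  obtain ⟨ε, hε, hεU⟩ := lebesgue_number_lemma_of_metric (isCompact_univ (X := M)) hUo
    (fun x _ => Set.mem_iUnion.2 ⟨x, hU x⟩)
  refine ⟨ε, hε, ?_, ?_⟩
  · intro C x e e' hC he he' hCx hee
    obtain ⟨i, hi⟩ := hεU x trivial
    have hmem : ∀ z : C, z.1 ∈ p ⁻¹' U i := fun z => hi (hCx ⟨z, z.2, rfl⟩)
    have := isPreconnected_iff_preconnectedSpace.1 hC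
    have hcont : Continuous fun z : C => (H i ⟨z.1, hmem z⟩).2 := by fun_prop
    have h1 := PreconnectedSpace.constant inferInstance hcont (x := ⟨e, he⟩) (y := ⟨e', he'⟩)
    have h2 : H i ⟨e, hmem ⟨e, he⟩⟩ = H i ⟨e', hmem ⟨e', he'⟩⟩ := by
      refine Prod.ext (Subtype.ext ?_) h1
      rw [hH, hH]
      exact hee
    exact congrArg Subtype.val ((H i).injective h2)
  · intro e x ρ hρ hx
    obtain ⟨i, hi⟩ := hεU (p e) trivial
    have hmem : ∀ z : Metric.ball (p e) ρ, z.1 ∈ U i :=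
      fun z => hi (Metric.ball_subset_ball hρ z.2)
    have hρ0 : 0 < ρ := dist_nonneg.trans_lt hx
    have hei : e ∈ p ⁻¹' U i := hmem ⟨p e, Metric.mem_ball_self hρ0⟩
    let s : Metric.ball (p e) ρ → E := fun z => (H i).symm (⟨z.1, hmem z⟩, (H i ⟨e, hei⟩).2)
    have hs : Continuous s := by fun_prop
    have hps : ∀ z, p (s z) = z := fun z => by
      rw [← hH]
      simp only [Homeomorph.apply_symm_apply]
    have := isPreconnected_iff_preconnectedSpace.1 (hball (p e) ρ)
    refine ⟨Set.range s, isPreconnected_range hs, ⟨⟨p e, Metric.mem_ball_self hρ0⟩, ?_⟩, ?_,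
      s ⟨x, by rwa [Metric.mem_ball, dist_comm]⟩, ⟨_, rfl⟩, hps _⟩
    · have : ((⟨p e, hmem ⟨p e, Metric.mem_ball_self hρ0⟩⟩, (H i ⟨e, hei⟩).2) : U i × _) =
          H i ⟨e, hei⟩ := Prod.ext (Subtype.ext (hH i ⟨e, hei⟩).symm) rfl
      simp only [s, this, Homeomorph.symm_apply_apply]
    · rintro _ ⟨_, ⟨z, rfl⟩, rfl⟩
      rw [hps]
      exact z.2

end Sheets

/-! ### Balls of Riemannian manifolds -/

/-- A path from `x` of length below `ρ` stays in the ball, since its initial segments are no longer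
than the whole. -/
theorem IsRiemannianManifold.isPreconnected_ball {n : ℕ} {M : Type*} [MetricSpace M]
    [ChartedSpace (EuclideanSpace ℝ (Fin n)) M] [IsManifold (𝓡 n) ∞ M]
    [Bundle.RiemannianBundle (fun x : M => TangentSpace (𝓡 n) x)]
    [IsRiemannianManifold (𝓡 n) M] (x : M) (ρ : ℝ) : IsPreconnected (Metric.ball x ρ) := by
  refine isPreconnected_of_forall x fun y hy => ?_
  have hρ : 0 < ρ := dist_nonneg.trans_lt hy
  have hxy : Manifold.riemannianEDist (𝓡 n) x y < ENNReal.ofReal ρ := by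
    rw [← IsRiemannianManifold.out (I := 𝓡 n) x y, edist_dist, ENNReal.ofReal_lt_ofReal_iff hρ,
      dist_comm]
    exact hy
  obtain ⟨γ, h0, h1, hγ, hl⟩ := Manifold.exists_lt_of_riemannianEDist_lt hxy
  refine ⟨γ '' Set.Icc 0 1, ?_, ⟨0, by simp, h0⟩, ⟨1, by simp, h1⟩,
    isPreconnected_Icc.image _ hγ.continuousOn⟩
  rintro _ ⟨s, hs, rfl⟩
  have h2 : Manifold.riemannianEDist (𝓡 n) x (γ s) ≤ Manifold.pathELength (𝓡 n) γ 0 s :=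
    Manifold.riemannianEDist_le_pathELength (hγ.mono (Set.Icc_subset_Icc_right hs.2)) h0 rfl hs.1
  have h3 := (h2.trans (Manifold.pathELength_mono le_rfl hs.2)).trans_lt hl
  rw [← IsRiemannianManifold.out (I := 𝓡 n) x (γ s), edist_dist,
    ENNReal.ofReal_lt_ofReal_iff hρ] at h3
  rwa [Metric.mem_ball, dist_comm]

/-! ### The group of lifts -/

namespace liftGroup

variable {Γ E M : Type*} [Group Γ] [TopologicalSpace E] [TopologicalSpace M] [MulAction Γ M]
  {p : E → M}

instance : MulAction (liftGroup Γ p) E where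
  smul f e := (f : E ≃ₜ E) e
  one_smul _ := rfl
  mul_smul _ _ _ := rfl

theorem _root_.IsCoveringMap.surjective_of_pathConnected [PathConnectedSpace M] [Nonempty E]
    (hp : IsCoveringMap p) : Function.Surjective p := by
  intro x
  obtain ⟨e⟩ := ‹Nonempty E›
  let γ := PathConnectedSpace.somePath (p e) x
  refine ⟨hp.liftPath γ.toContinuousMap e γ.source 1, ?_⟩
  have := congrFun (hp.liftPath_lifts γ.toContinuousMap e γ.source) 1
  exact this.trans γ.target

theorem ext_of_apply_eq [PreconnectedSpace E] (hp : IsCoveringMap p) {γ : Γ} {f g : E ≃ₜ E}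
    (hf : ∀ e, p (f e) = γ • p e) (hg : ∀ e, p (g e) = γ • p e) {e : E} (h : f e = g e) : f = g :=
  Homeomorph.ext (congrFun (hp.eq_of_comp_eq f.continuous g.continuous
    (funext fun z => (hf z).trans (hg z).symm) e h))

/-- Lift `γ ∘ p` and `γ⁻¹ ∘ p`; uniqueness of lifts makes the two maps mutually inverse. -/
theorem exists_smul_eq [SimplyConnectedSpace E] [LocallyPathConnectedSpace E]
    [ContinuousConstSMul Γ M] (hp : IsCoveringMap p) (γ : Γ) {e e' : E} (h : p e' = γ • p e) :
    ∃ f : liftGroup Γ p, (∀ z, p (f • z) = γ • p z) ∧ f • e = e' := by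
  obtain ⟨F, ⟨hF, hF'⟩, -⟩ := hp.existsUnique_continuousMap_lifts
    (⟨fun z => γ • p z, hp.continuous.const_smul γ⟩ : C(E, M)) e e' h
  obtain ⟨G, ⟨hG, hG'⟩, -⟩ := hp.existsUnique_continuousMap_lifts
    (⟨fun z => γ⁻¹ • p z, hp.continuous.const_smul γ⁻¹⟩ : C(E, M)) e' e
      (by simp [h])
  have hF1 : ∀ z, p (F z) = γ • p z := congrFun hF'
  have hG1 : ∀ z, p (G z) = γ⁻¹ • p z := congrFun hG'
  have h1 : G ∘ F = id := hp.eq_of_comp_eq (G.continuous.comp F.continuous) continuous_id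
    (funext fun z => by simp [hF1, hG1]) e (by simp [hF, hG])
  have h2 : F ∘ G = id := hp.eq_of_comp_eq (F.continuous.comp G.continuous) continuous_id
    (funext fun z => by simp [hF1, hG1]) e' (by simp [hF, hG])
  exact ⟨⟨⟨⟨F, G, congrFun h1, congrFun h2⟩, F.continuous, G.continuous⟩, γ, hF1⟩, hF1, hF⟩

variable [Nonempty E] (hfree : ∀ (γ : Γ) (x : M), γ • x = x → γ = 1)

include hfree in
theorem eq_of_smul_eq {γ η : Γ} {x : M} (h : γ • x = η • x) : γ = η :=
  (inv_mul_eq_one.1 (hfree (η⁻¹ * γ) x (by rw [mul_smul, h, inv_smul_smul]))).symm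

/-- The element of `Γ` covered by a lift. -/
noncomputable def rightHom : liftGroup Γ p →* Γ :=
  MonoidHom.mk' (fun f => f.2.choose) (fun f g => by
    obtain ⟨e⟩ := ‹Nonempty E›
    refine eq_of_smul_eq hfree (x := p e) ?_
    rw [← (f * g).2.choose_spec, mul_smul, ← g.2.choose_spec, ← f.2.choose_spec]
    rfl)

theorem apply_smul (f : liftGroup Γ p) (e : E) : p (f • e) = rightHom hfree f • p e :=
  f.2.choose_spec e

theorem rightHom_eq {f : liftGroup Γ p} {γ : Γ} {e : E} (h : p (f • e) = γ • p e) :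
    rightHom hfree f = γ :=
  eq_of_smul_eq hfree (x := p e) ((apply_smul hfree f e).symm.trans h)

theorem eq_of_rightHom_eq [PreconnectedSpace E] (hp : IsCoveringMap p) {f g : liftGroup Γ p}
    (h : rightHom hfree f = rightHom hfree g) {e : E} (he : f • e = g • e) : f = g :=
  Subtype.ext (ext_of_apply_eq hp (apply_smul hfree f)
    (fun e => by rw [h]; exact apply_smul hfree g e) he)

theorem rightHom_surjective [SimplyConnectedSpace E] [LocallyPathConnectedSpace E]
    [ContinuousConstSMul Γ M] (hp : IsCoveringMap p) (hs : Function.Surjective p) :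
    Function.Surjective (rightHom (p := p) hfree) := by
  intro γ
  obtain ⟨e⟩ := ‹Nonempty E›
  obtain ⟨e', he'⟩ := hs (γ • p e)
  obtain ⟨f, hf, -⟩ := exists_smul_eq hp γ he'
  exact ⟨f, rightHom_eq hfree (hf e)⟩

theorem isQuotientCoveringMap_ker [SimplyConnectedSpace E] [LocallyPathConnectedSpace E]
    [ContinuousConstSMul Γ M] (hp : IsCoveringMap p) (hs : Function.Surjective p) :
    IsQuotientCoveringMap p (rightHom (p := p) hfree).ker := by
  refine (isQuotientCoveringMap_iff_isCoveringMap_and p _).2 ⟨hp, hs, ⟨fun f => ?_⟩, ?_, ?_⟩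
  · exact (f.1.1 : E ≃ₜ E).continuous
  · rw [isCancelSMul_iff_eq_one_of_smul_eq]
    intro f e he
    refine Subtype.ext (eq_of_rightHom_eq hfree hp (e := e) ?_ ?_)
    · rw [(MonoidHom.mem_ker).1 f.2, OneMemClass.coe_one, map_one]
    · rw [OneMemClass.coe_one, one_smul]
      exact he
  · intro e₁ e₂
    constructor
    · intro h
      obtain ⟨f, hf, hfe⟩ := exists_smul_eq (Γ := Γ) hp 1 (e := e₂) (e' := e₁) (by simpa using h)
      exact ⟨⟨f, MonoidHom.mem_ker.2 (rightHom_eq hfree (hf e₂))⟩, hfe⟩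
    · rintro ⟨f, rfl⟩
      have := apply_smul hfree f.1 e₂
      rw [MonoidHom.mem_ker.1 f.2, one_smul] at this
      exact this

include hfree in
theorem exists_groupExtension [SimplyConnectedSpace E] [LocallyPathConnectedSpace E]
    [ContinuousConstSMul Γ M] (hp : IsCoveringMap p) (hs : Function.Surjective p) (p₀ : M) :
    ∃ ext : GroupExtension (FundamentalGroup M p₀) (liftGroup Γ p) Γ,
      ∀ (f : liftGroup Γ p) (e : E), p ((f : E ≃ₜ E) e) = ext.rightHom f • p e := by
  obtain ⟨e, he⟩ := hs p₀
  -- `fundamentalGroupEquiv` takes values in the opposite of the deck group; inversion corrects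
  -- this.
  let ψ : FundamentalGroup M p₀ ≃* (rightHom (p := p) hfree).ker :=
    ((isQuotientCoveringMap_ker hfree hp hs).fundamentalGroupEquiv ⟨e, he⟩).trans
      (MulEquiv.inv' _).symm
  refine ⟨{ inl := (rightHom (p := p) hfree).ker.subtype.comp ψ.toMonoidHom
            rightHom := rightHom hfree
            inl_injective := Subtype.val_injective.comp ψ.injective
            range_inl_eq_ker_rightHom := ?_
            rightHom_surjective := rightHom_surjective hfree hp hs }, apply_smul hfree⟩
  rw [MonoidHom.range_comp, MonoidHom.range_eq_top.2 ψ.surjective, ← MonoidHom.range_eq_map,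
    Subgroup.range_subtype]

end liftGroup

/-! ### The coarse universal cover of a level set -/

section LevelSetCover

open Topology

variable {Γ E M : Type*} [Group Γ] (S : FiniteSymmGenSet Γ) [TopologicalSpace E] [MetricSpace M]
  [MulAction Γ M] {p : E → M} {t r : ℝ}

/-- The projection of `E × Γ` to the level set. -/
def levelProj (p : E → M) (ht : 0 < t) (y : E × Γ) : LevelSet M S t ht :=
  LevelSet.mk S ht (p y.1, y.2)

/-- Adjacency in `E × Γ`, where `E` carries the scaled metric lifted along `p`. -/
def CoverEdge (p : E → M) (t r : ℝ) (y y' : E × Γ) : Prop :=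
  -- No metric on `E` is needed: the connected set `C` certifies, when its image is small, that both
  -- points lie on one sheet.
  ∃ C : Set E, IsPreconnected C ∧ y.1 ∈ C ∧ y'.1 ∈ C ∧
    ∀ a ∈ C, t * dist (p y.1) (p a) + S.wordDist y.2 y'.2 < r

variable {S}

theorem dist_levelProj_le (ht : 0 < t) (e e' : E) (g g' : Γ) :
    dist (levelProj S p ht (e, g)) (levelProj S p ht (e', g')) ≤
      t * dist (p e) (p e') + S.wordDist g g' :=
  LevelSet.dist_le _ _

section Cocycle

variable [IsIsometricSMul Γ M] {K : Type*} [Group K]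

/-- The horizontal edge is carried from level `1` to level `g` one generator at a time. Each step
crosses a rectangle with sides at most `1`, split by a diagonal shorter than `2 ≤ r` into two
admissible triangles. -/
theorem levelProj_cocycle_local (ht : 0 < t) (hr : 2 ≤ r)
    {c : LevelSet M S t ht → LevelSet M S t ht → K}
    (hc : ∀ x y z, dist x y < r → dist y z < r → dist x z < r → c x y * c y z = c x z)
    {k : E → Γ → K} (hk : ∀ e g g', (S.wordDist g g' : ℝ) < r →
      c (levelProj S p ht (e, g)) (levelProj S p ht (e, g')) = (k e g)⁻¹ * k e g')
    {h : E → K} {a b : E} (hab : t * dist (p a) (p b) < 1)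
    (hh : c (levelProj S p ht (a, 1)) (levelProj S p ht (b, 1)) = (h a)⁻¹ * h b) (g : Γ) :
    c (levelProj S p ht (a, g)) (levelProj S p ht (b, g)) =
      (h a * (k a 1)⁻¹ * k a g)⁻¹ * (h b * (k b 1)⁻¹ * k b g) := by
  obtain ⟨l, hl, rfl⟩ := S.exists_word g
  induction l using List.reverseRecOn with
  | nil => simpa using hh
  | append_singleton l s ih =>
    have hs : S.wordLength s ≤ 1 := S.wordLength_le_one (hl s (by simp))
    have ih := ih fun x hx => hl x (by simp [hx])
    rw [List.prod_append, List.prod_singleton]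
    set g := l.prod
    have h1 : S.wordDist g (g * s) ≤ 1 := by simpa [FiniteSymmGenSet.wordDist] using hs
    have h1' : (S.wordDist g (g * s) : ℝ) ≤ 1 := by exact_mod_cast h1
    have h2 : (S.wordDist (g * s) g : ℝ) ≤ 1 := by rwa [S.wordDist_comm]
    have d1 := dist_levelProj_le (S := S) (p := p) ht a a (g * s) g
    have d2 := dist_levelProj_le (S := S) (p := p) ht a b g g
    have d3 := dist_levelProj_le (S := S) (p := p) ht a b (g * s) g
    have d4 := dist_levelProj_le (S := S) (p := p) ht b b g (g * s)
    have d5 := dist_levelProj_le (S := S) (p := p) ht a b (g * s) (g * s)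
    rw [dist_self, mul_zero, zero_add] at d1 d4
    rw [S.wordDist_self, Nat.cast_zero, add_zero] at d2 d5
    rw [← hc _ (levelProj S p ht (b, g)) _ (by linarith) (by linarith) (by linarith),
      ← hc _ (levelProj S p ht (a, g)) _ (by linarith) (by linarith) (by linarith), ih,
      hk a _ _ (by linarith), hk b _ _ (by linarith)]
    group

theorem levelProj_cocycle_trivial [SimplyConnectedSpace E] [LocallyPathConnectedSpace E]
    (hp : Continuous p) (ht : 0 < t) (hr : 2 ≤ r)
    (hΓ : ∀ f : Γ → Γ → K, S.IsCocycle r f →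
      ∃ h : Γ → K, ∀ a b, (S.wordDist a b : ℝ) < r → f a b = (h a)⁻¹ * h b)
    (c : LevelSet M S t ht → LevelSet M S t ht → K)
    (hc : ∀ x y z, dist x y < r → dist y z < r → dist x z < r → c x y * c y z = c x z) :
    ∃ F : E × Γ → K, ∀ y y', CoverEdge S p t r y y' →
      c (levelProj S p ht y) (levelProj S p ht y') = (F y)⁻¹ * F y' := by
  have hk : ∀ e : E, ∃ k : Γ → K, ∀ g g', (S.wordDist g g' : ℝ) < r →
      c (levelProj S p ht (e, g)) (levelProj S p ht (e, g')) = (k g)⁻¹ * k g' := by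
    intro e
    have hd : ∀ g g', (S.wordDist g g' : ℝ) < r →
        dist (levelProj S p ht (e, g)) (levelProj S p ht (e, g')) < r := by
      intro g g' h
      have := dist_levelProj_le (S := S) (p := p) ht e e g g'
      rw [dist_self, mul_zero, zero_add] at this
      exact this.trans_lt h
    exact hΓ _ fun a b d h1 h2 h3 => hc _ _ _ (hd _ _ h1) (hd _ _ h2) (hd _ _ h3)
  choose k hk using hk
  have hball : ∀ e : E, ∃ U : Set E, IsOpen U ∧ e ∈ U ∧
      ∀ a ∈ U, ∀ b ∈ U, t * dist (p a) (p b) < 1 := by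
    intro e
    refine ⟨p ⁻¹' Metric.ball (p e) (1 / (2 * t)), Metric.isOpen_ball.preimage hp,
      Metric.mem_ball_self (by positivity), fun a ha b hb => ?_⟩
    have h1 : dist (p a) (p b) < 1 / (2 * t) + 1 / (2 * t) :=
      (dist_triangle_right _ _ (p e)).trans_lt (add_lt_add ha hb)
    calc t * dist (p a) (p b) < t * (1 / (2 * t) + 1 / (2 * t)) := by gcongr
      _ = 1 := by field_simp; norm_num
  have hd : ∀ (a b : E) (g : Γ), t * dist (p a) (p b) < r →
      dist (levelProj S p ht (a, g)) (levelProj S p ht (b, g)) < r := by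
    intro a b g h
    have := dist_levelProj_le (S := S) (p := p) ht a b g g
    rw [S.wordDist_self, Nat.cast_zero, add_zero] at this
    exact this.trans_lt h
  obtain ⟨h, hh⟩ := exists_locally_coboundary
    (f := fun a b : E => c (levelProj S p ht (a, 1)) (levelProj S p ht (b, 1))) (by
      intro e
      obtain ⟨U, hU, he, hUd⟩ := hball e
      have hd' : ∀ a ∈ U, ∀ b ∈ U,
          dist (levelProj S p ht (a, (1 : Γ))) (levelProj S p ht (b, 1)) < r :=
        fun a ha b hb => hd a b 1 (by linarith [hUd a ha b hb])
      exact ⟨U, hU, he, fun a ha b hb d hd => hc _ _ _ (hd' a ha b hb) (hd' b hb d hd)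
        (hd' a ha d hd)⟩)
  -- Each `k e` is determined only up to a left factor; it is normalized at `1` and then matched
  -- with `h` on `E × {1}`.
  let F : E × Γ → K := fun y => h y.1 * (k y.1 1)⁻¹ * k y.1 y.2
  have hloc : ∀ e : E, ∀ᶠ b in 𝓝 e, t * dist (p e) (p b) < 1 ∧ ∀ g,
      c (levelProj S p ht (e, g)) (levelProj S p ht (b, g)) = (F (e, g))⁻¹ * F (b, g) := by
    intro e
    obtain ⟨U, hU, he, hUd⟩ := hball e
    obtain ⟨V, hV, he', hVh⟩ := hh e
    filter_upwards [hU.mem_nhds he, hV.mem_nhds he'] with b hb hb'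
    exact ⟨hUd e he b hb, levelProj_cocycle_local ht hr hc hk (hUd e he b hb) (hVh e he' b hb')⟩
  have hone : ∀ x, c x x = 1 := by
    intro x
    have h0 : dist x x < r := by rw [dist_self]; linarith
    have := hc x x x h0 h0 h0
    rwa [mul_eq_left] at this
  refine ⟨F, ?_⟩
  rintro ⟨e, g⟩ ⟨e', g'⟩ ⟨C, hC, he, he', hCr⟩
  have hw0 : (0 : ℝ) ≤ S.wordDist g g' := Nat.cast_nonneg _
  have hCr' : ∀ a ∈ C, t * dist (p e) (p a) < r := fun a ha => by
    have := hCr a ha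
    dsimp only at this
    linarith
  have hw : (S.wordDist g g' : ℝ) < r := by
    have := hCr e he
    simpa using this
  -- An edge is split into a horizontal part inside level `g`, continued along `C`, and a vertical
  -- part in the fibre over `e'`.
  have h1 : c (levelProj S p ht (e, g)) (levelProj S p ht (e', g)) =
      (F (e, g))⁻¹ * F (e', g) := by
    refine eq_coboundary_of_isPreconnected (f := fun a b =>
      c (levelProj S p ht (a, g)) (levelProj S p ht (b, g))) (h := fun a => F (a, g)) hC he
      (hone _) (fun b hb => ?_) he'
    filter_upwards [self_mem_nhdsWithin, mem_nhdsWithin_of_mem_nhds (hloc b)] with b' hb' hbb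
    exact ⟨hc _ _ _ (hd _ _ _ (hCr' b hb)) (hd _ _ _ (by linarith [hbb.1]))
      (hd _ _ _ (hCr' b' hb')), hbb.2 g⟩
  have h2 := hk e' g g' hw
  have d2 := dist_levelProj_le (S := S) (p := p) ht e' e' g g'
  rw [dist_self, mul_zero, zero_add] at d2
  rw [← hc _ (levelProj S p ht (e', g)) _ (hd _ _ _ (hCr' e' he')) (d2.trans_lt hw)
    ((dist_levelProj_le ht e e' g g').trans_lt (hCr e' he')), h1, h2]
  simp only [F]
  group

end Cocycle

end LevelSetCover

/-! ### Deck transformations of the coarse universal cover -/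

section Deck

open Topology

variable {Γ E M : Type*} [Group Γ] {S : FiniteSymmGenSet Γ} [TopologicalSpace E] [MetricSpace M]
  [MulAction Γ M] {p : E → M} {t r : ℝ}

-- Each nontrivial `γ` has a positive minimal displacement by freeness and compactness, and only
-- finitely many `γ` have bounded length.
variable (S) in
theorem FiniteSymmGenSet.exists_displacement_lower_bound [IsIsometricSMul Γ M] [CompactSpace M]
    [Nonempty M] (hfree : ∀ (γ : Γ) (x : M), γ • x = x → γ = 1) (n : ℕ) :
    ∃ κ > 0, ∀ γ : Γ, S.wordLength γ ≤ n → γ ≠ 1 → ∀ x : M, κ ≤ dist x (γ • x) := by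
  have h : ∀ γ : Γ, ∀ᶠ κ : ℝ in 𝓝[>] 0, γ ≠ 1 → ∀ x : M, κ ≤ dist x (γ • x) := by
    intro γ
    by_cases hγ : γ = 1
    · simp [hγ]
    obtain ⟨x₀, -, hx₀⟩ := isCompact_univ.exists_isMinOn Set.univ_nonempty
      (f := fun x : M => dist x (γ • x))
      (continuous_id.dist (isometry_smul M γ).continuous).continuousOn
    have hpos : 0 < dist x₀ (γ • x₀) := dist_pos.2 fun h => hγ (hfree γ x₀ h.symm)
    filter_upwards [Ioo_mem_nhdsGT hpos] with κ hκ _ x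
    exact hκ.2.le.trans (hx₀ (Set.mem_univ x))
  have h2 := (Filter.eventually_all_finite (S.finite_setOf_wordLength_le n)).2 fun γ _ => h γ
  obtain ⟨κ, hκ, hκ0⟩ := (h2.and self_mem_nhdsWithin).exists
  exact ⟨κ, hκ0, hκ⟩

/-- The diagonal action of the group of lifts on `E × Γ`. -/
@[reducible]
noncomputable def liftGroup.prodAction [Nonempty E]
    (hfree : ∀ (γ : Γ) (x : M), γ • x = x → γ = 1) : MulAction (liftGroup Γ p) (E × Γ) where
  smul f y := (f • y.1, liftGroup.rightHom hfree f * y.2)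
  one_smul y := Prod.ext (one_smul _ y.1) (by
    change liftGroup.rightHom hfree 1 * y.2 = y.2
    rw [map_one, one_mul])
  mul_smul f g y := Prod.ext (mul_smul f g y.1) (by
    change liftGroup.rightHom hfree (f * g) * y.2 = _ * (_ * y.2)
    rw [map_mul, mul_assoc])

theorem levelProj_eq_iff {ht : 0 < t} {y y' : E × Γ} :
    levelProj S p ht y = levelProj S p ht y' ↔ ∃ γ : Γ, γ • p y'.1 = p y.1 ∧ γ * y'.2 = y.2 := by
  rw [levelProj, levelProj, LevelSet.mk_eq_iff]
  simp [Prod.ext_iff]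

theorem CoverEdge.refl (hr : 0 < r) (y : E × Γ) : CoverEdge S p t r y y :=
  ⟨{y.1}, isPreconnected_singleton, rfl, rfl, by
    rintro a rfl
    simpa [S.wordDist_self] using hr⟩

theorem CoverEdge.dist_lt {ht : 0 < t} {y y' : E × Γ} (h : CoverEdge S p t r y y') :
    dist (levelProj S p ht y) (levelProj S p ht y') < r := by
  obtain ⟨C, -, -, h1, h2⟩ := h
  exact (dist_levelProj_le ht y.1 y'.1 y.2 y'.2).trans_lt (h2 _ h1)

theorem CoverEdge.exists_nearby (ht : 0 < t) {y y' : E × Γ} (h : CoverEdge S p t r y y') :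
    ∃ C : Set E, IsPreconnected C ∧ y.1 ∈ C ∧ y'.1 ∈ C ∧ (∀ a ∈ C, dist (p y.1) (p a) < r / t) ∧
      (S.wordDist y.2 y'.2 : ℝ) < r := by
  obtain ⟨C, hC, h1, h2, h3⟩ := h
  refine ⟨C, hC, h1, h2, fun a ha => ?_, ?_⟩
  · rw [lt_div_iff₀ ht, mul_comm]
    have := h3 a ha
    have h0 : (0 : ℝ) ≤ S.wordDist y.2 y'.2 := Nat.cast_nonneg _
    linarith
  · simpa using h3 _ h1

theorem CoverEdge.smul [IsIsometricSMul Γ M] [Nonempty E]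
    (hfree : ∀ (γ : Γ) (x : M), γ • x = x → γ = 1) (f : liftGroup Γ p) {y y' : E × Γ}
    (h : CoverEdge S p t r y y') :
    CoverEdge S p t r (f • y.1, liftGroup.rightHom hfree f * y.2)
      (f • y'.1, liftGroup.rightHom hfree f * y'.2) := by
  obtain ⟨C, hC, h1, h2, h3⟩ := h
  refine ⟨(fun e => f • e) '' C, hC.image _ (f.1.continuous.continuousOn), ⟨_, h1, rfl⟩,
    ⟨_, h2, rfl⟩, ?_⟩
  rintro _ ⟨a, ha, rfl⟩
  simp only [liftGroup.apply_smul hfree, dist_smul, S.wordDist_smul]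
  exact h3 a ha

theorem reflTransGen_coverEdge [ConnectedSpace E] [LocallyPathConnectedSpace E]
    (hp : Continuous p) (ht : 0 < t) (hr : 1 < r) (y y' : E × Γ) :
    Relation.ReflTransGen (CoverEdge S p t r) y y' := by
  obtain ⟨e, g⟩ := y
  obtain ⟨e', g'⟩ := y'
  have h1 : Relation.ReflTransGen (CoverEdge S p t r) (e, g) (e', g) := by
    refine PreconnectedSpace.induction₂'
      (fun a b => Relation.ReflTransGen (CoverEdge S p t r) (a, g) (b, g)) (fun x => ?_)
      ⟨fun _ _ _ h h' => h.trans h'⟩ e e'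
    have hr0 : 0 < r := by linarith
    have hnhds : p ⁻¹' Metric.ball (p x) (r / (2 * t)) ∈ 𝓝 x :=
      (Metric.isOpen_ball.preimage hp).mem_nhds (Metric.mem_ball_self (by positivity))
    obtain ⟨U, ⟨hU, hUc⟩, hUs⟩ := (path_connected_basis x).mem_iff.1 hnhds
    have hedge : ∀ a ∈ U, ∀ b ∈ U, CoverEdge S p t r (a, g) (b, g) := fun a ha b hb =>
      ⟨U, hUc.isConnected.isPreconnected, ha, hb, fun z hz => by
        have h1 : dist (p a) (p z) < r / (2 * t) + r / (2 * t) :=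
          (dist_triangle_right _ _ (p x)).trans_lt (add_lt_add (hUs ha) (hUs hz))
        rw [S.wordDist_self, Nat.cast_zero, add_zero]
        calc t * dist (p a) (p z) < t * (r / (2 * t) + r / (2 * t)) := by gcongr
          _ = r := by field_simp; ring⟩
    filter_upwards [hU] with b hb
    exact ⟨.single (hedge x (mem_of_mem_nhds hU) b hb), .single (hedge b hb x (mem_of_mem_nhds hU))⟩
  refine h1.trans ?_
  obtain ⟨l, hl, hlp⟩ := S.exists_word (g⁻¹ * g')
  obtain rfl : g' = g * l.prod := by rw [hlp, mul_inv_cancel_left]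
  clear hlp h1
  induction l using List.reverseRecOn with
  | nil => rw [List.prod_nil, mul_one]
  | append_singleton l s ih =>
    refine (ih fun x hx => hl x (by simp [hx])).tail
      ⟨{e'}, isPreconnected_singleton, rfl, rfl, ?_⟩
    rintro a rfl
    have hs : (S.wordLength s : ℝ) ≤ 1 := by exact_mod_cast S.wordLength_le_one (hl s (by simp))
    rw [List.prod_append, List.prod_singleton, ← mul_assoc, FiniteSymmGenSet.wordDist,
      inv_mul_cancel_left, dist_self, mul_zero, zero_add]
    linarith

/-- Four edges cost less than `4 * r` in `Γ` and `4 * r / t` in `M`, which forces `f` to cover the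
identity. The union of the four connected sets then joins `z.1` to `f • z.1` inside one sheet, so
`f` fixes `z.1`. -/
theorem CoverEdge.eq_one_of_square [IsIsometricSMul Γ M] [Nonempty E] [PreconnectedSpace E]
    (hp : IsCoveringMap p) (hfree : ∀ (γ : Γ) (x : M), γ • x = x → γ = 1) (ht : 0 < t)
    {ε κ : ℝ} (hε : ∀ (C : Set E) (x : M) (e e' : E), IsPreconnected C → e ∈ C → e' ∈ C →
      p '' C ⊆ Metric.ball x ε → p e = p e' → e = e')
    (hκ : ∀ γ : Γ, (S.wordLength γ : ℝ) ≤ 4 * r → γ ≠ 1 → ∀ x : M, κ ≤ dist x (γ • x))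
    (hrε : 4 * r ≤ t * ε) (hrκ : 4 * r ≤ t * κ) {y a b z : E × Γ} {f : liftGroup Γ p}
    (h1 : CoverEdge S p t r y a) (h2 : CoverEdge S p t r a z) (h3 : CoverEdge S p t r y b)
    (h4 : CoverEdge S p t r b (f • z.1, liftGroup.rightHom hfree f * z.2)) : f = 1 := by
  obtain ⟨C₁, c1, y1, a1, d1, w1⟩ := h1.exists_nearby ht
  obtain ⟨C₂, c2, a2, z2, d2, w2⟩ := h2.exists_nearby ht
  obtain ⟨C₃, c3, y3, b3, d3, w3⟩ := h3.exists_nearby ht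
  obtain ⟨C₄, c4, b4, z4, d4, w4⟩ := h4.exists_nearby ht
  dsimp only at z4 w4
  have hrε' : 4 * (r / t) ≤ ε := by
    rw [← mul_div_assoc, div_le_iff₀ ht, mul_comm ε]
    exact hrε
  have hrκ' : 4 * (r / t) ≤ κ := by
    rw [← mul_div_assoc, div_le_iff₀ ht, mul_comm κ]
    exact hrκ
  have hδ : 0 < r / t := dist_nonneg.trans_lt (d1 _ y1)
  set q := liftGroup.rightHom hfree f
  have hq : q = 1 := by
    have hw : (S.wordDist z.2 (q * z.2) : ℝ) < 4 * r := by
      have t1 : (S.wordDist z.2 (q * z.2) : ℝ) ≤ S.wordDist z.2 y.2 + S.wordDist y.2 (q * z.2) := by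
        exact_mod_cast S.wordDist_triangle _ _ _
      have t2 : (S.wordDist z.2 y.2 : ℝ) ≤ S.wordDist y.2 a.2 + S.wordDist a.2 z.2 := by
        rw [S.wordDist_comm z.2]
        exact_mod_cast S.wordDist_triangle _ _ _
      have t3 : (S.wordDist y.2 (q * z.2) : ℝ) ≤ S.wordDist y.2 b.2 + S.wordDist b.2 (q * z.2) := by
        exact_mod_cast S.wordDist_triangle _ _ _
      linarith
    have hd : dist (p z.1) (q • p z.1) < κ := by
      rw [← liftGroup.apply_smul hfree]
      have t1 := dist_triangle (p z.1) (p y.1) (p (f • z.1))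
      have t2 := dist_triangle (p y.1) (p a.1) (p z.1)
      have t3 := dist_triangle (p y.1) (p b.1) (p (f • z.1))
      rw [dist_comm (p z.1) (p y.1)] at t1
      linarith [d1 _ a1, d2 _ z2, d3 _ b3, d4 _ z4]
    by_contra hne
    refine hd.not_ge ?_
    -- The word metric is left-invariant, so it is the conjugate of `q` by `z.2` that is short; it
    -- is applied at the translated point.
    have := hκ (z.2⁻¹ * (q * z.2)) hw.le
      (fun h => hne (by rwa [inv_mul_eq_one, eq_comm, mul_eq_right] at h)) (z.2⁻¹ • p z.1)
    rwa [mul_smul, dist_smul, mul_smul, smul_inv_smul] at this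
  refine liftGroup.eq_of_rightHom_eq hfree hp (e := z.1) (hq.trans (map_one _).symm) ?_
  rw [one_smul]
  refine hε (C₁ ∪ C₂ ∪ (C₃ ∪ C₄)) (p y.1) _ _ ?_ (Or.inr (Or.inr z4)) (Or.inl (Or.inr z2)) ?_ ?_
  · exact (c1.union a.1 a1 a2 c2).union y.1 (Or.inl y1) (Or.inl y3) (c3.union b.1 b3 b4 c4)
  · rintro _ ⟨u, (hu | hu) | (hu | hu), rfl⟩ <;> rw [Metric.mem_ball, dist_comm]
    · linarith [d1 u hu]
    · linarith [d2 u hu, d1 _ a1, dist_triangle (p y.1) (p a.1) (p u)]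
    · linarith [d3 u hu]
    · linarith [d4 u hu, d3 _ b3, dist_triangle (p y.1) (p b.1) (p u)]
  · rw [liftGroup.apply_smul (p := p) hfree]
    change q • _ = _
    rw [hq, one_smul]

theorem isCoarseRegularCover_levelProj [IsIsometricSMul Γ M] [SimplyConnectedSpace E]
    [LocallyPathConnectedSpace E] (hp : IsCoveringMap p) (hs : Function.Surjective p)
    (hfree : ∀ (γ : Γ) (x : M), γ • x = x → γ = 1) (ht : 0 < t) (hr : 1 < r) {ε κ : ℝ}
    (hε : ∀ (C : Set E) (x : M) (e e' : E), IsPreconnected C → e ∈ C → e' ∈ C →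
      p '' C ⊆ Metric.ball x ε → p e = p e' → e = e')
    (hε' : ∀ (e : E) (x : M) (ρ : ℝ), ρ ≤ ε → dist (p e) x < ρ → ∃ C : Set E, IsPreconnected C ∧
      e ∈ C ∧ p '' C ⊆ Metric.ball (p e) ρ ∧ ∃ e' ∈ C, p e' = x)
    (hκ : ∀ γ : Γ, (S.wordLength γ : ℝ) ≤ 4 * r → γ ≠ 1 → ∀ x : M, κ ≤ dist x (γ • x))
    (hrε : 4 * r ≤ t * ε) (hrκ : 4 * r ≤ t * κ) :
    letI := liftGroup.prodAction (p := p) hfree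
    IsCoarseRegularCover (LevelSet M S t ht) (G := liftGroup Γ p) r (levelProj S p ht)
      (CoverEdge S p t r) := by
  have hr0 : 0 < r := by linarith
  let _ := liftGroup.prodAction (p := p) hfree
  refine ⟨?_, ?_, ?_, ?_, CoverEdge.refl hr0, fun _ _ => CoverEdge.dist_lt, ?_, ?_,
    reflTransGen_coverEdge hp.continuous ht hr⟩
  · intro x
    obtain ⟨⟨m, g⟩, rfl⟩ := LevelSet.mk_surjective x
    obtain ⟨e, rfl⟩ := hs m
    exact ⟨(e, g), rfl⟩
  · intro f y
    exact levelProj_eq_iff.2 ⟨liftGroup.rightHom hfree f,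
      (liftGroup.apply_smul hfree f y.1).symm, rfl⟩
  · intro y y' h
    obtain ⟨γ, h1, h2⟩ := levelProj_eq_iff.1 h.symm
    obtain ⟨f, hf, hfe⟩ := liftGroup.exists_smul_eq hp γ h1.symm
    refine ⟨f, Prod.ext hfe ?_⟩
    change liftGroup.rightHom hfree f * y.2 = y'.2
    rw [liftGroup.rightHom_eq hfree (hf y.1), h2]
  · exact fun f y y' h => h.smul hfree f
  · intro y x hx
    obtain ⟨⟨m, g⟩, rfl, hlt⟩ := LevelSet.exists_lt_left hx
    simp only [productDist] at hlt
    set w : ℝ := (S.wordDist y.2 g : ℝ)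
    have hw : 0 ≤ w := Nat.cast_nonneg _
    -- The radius is what remains of the budget `r` after the word part `w`, rescaled to `M`.
    have hρ : (r - w) / t ≤ ε := by
      rw [div_le_iff₀ ht, mul_comm]
      linarith
    obtain ⟨C, hC, he, hCb, e', he', rfl⟩ := hε' y.1 m ((r - w) / t) hρ (by
      rw [lt_div_iff₀ ht, mul_comm]
      linarith)
    refine ⟨(e', g), ⟨C, hC, he, he', fun a ha => ?_⟩, rfl⟩
    have := hCb ⟨a, ha, rfl⟩
    rw [Metric.mem_ball, dist_comm, lt_div_iff₀ ht, mul_comm] at this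
    change t * dist (p y.1) (p a) + w < r
    linarith
  · exact fun y a b z f h1 h2 h3 h4 =>
      CoverEdge.eq_one_of_square hp hfree ht hε hκ hrε hrκ h1 h2 h3 h4

end Deck

/-! ### The main theorem: choice of the scales -/

theorem mainTheorem4 {n : ℕ} {Γ M E : Type*}
    [Group Γ] [Group.IsFinitelyPresented Γ] (S : FiniteSymmGenSet Γ)
    [MetricSpace M] [ChartedSpace (EuclideanSpace ℝ (Fin n)) M] [IsManifold (𝓡 n) ∞ M]
    [Bundle.RiemannianBundle (fun x : M => TangentSpace (𝓡 n) x)]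
    [IsContMDiffRiemannianBundle (𝓡 n) ∞ (EuclideanSpace ℝ (Fin n))
      (fun x : M => TangentSpace (𝓡 n) x)]
    [IsRiemannianManifold (𝓡 n) M] [CompactSpace M] [ConnectedSpace M]
    [MulAction Γ M] [IsIsometricSMul Γ M] [MulAction.IsMinimal Γ M]
    (hfree : ∀ (γ : Γ) (x : M), γ • x = x → γ = 1)
    [TopologicalSpace E] (p : E → M) (hp : IsUniversalCover p) :
    (∃ r₀ : ℝ, 0 < r₀ ∧ ∀ (r : ℝ) (hr : 0 < r), r₀ ≤ r →
      ∃ t₀ : ℝ, 0 < t₀ ∧ ∀ (t : ℝ) (ht : 0 < t), t₀ ≤ t → ∀ p₀ : M,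
        Nonempty (CoarsePi1 (LevelSet.ofPoint S ht p₀) r hr ≃* liftGroup Γ p)) ∧
    ∀ p₀ : M, ∃ ext : GroupExtension (FundamentalGroup M p₀) (liftGroup Γ p) Γ,
      ∀ (f : liftGroup Γ p) (e : E), p ((f : E ≃ₜ E) e) = ext.rightHom f • p e := by
  obtain ⟨hcov, hsc⟩ := hp
  have : LocallyPathConnectedSpace M :=
    ChartedSpace.locallyPathConnectedSpace (EuclideanSpace ℝ (Fin n)) M
  have : PathConnectedSpace M := PathConnectedSpace.of_locallyPathConnectedSpace
  have : LocallyPathConnectedSpace E := hcov.isLocalHomeomorph.locallyPathConnectedSpace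
  have hs : Function.Surjective p := hcov.surjective_of_pathConnected
  refine ⟨?_, fun p₀ => liftGroup.exists_groupExtension hfree hcov hs p₀⟩
  obtain ⟨B, hB⟩ := S.exists_scale_isCocycle_trivial
  obtain ⟨ε, hε, hε1, hε2⟩ := hcov.exists_sheets
    (IsRiemannianManifold.isPreconnected_ball (n := n) (M := M))
  -- The `2` serves the thin rectangles; `B + 1` gives the strict inequality `B < r`.
  refine ⟨max 2 (B + 1), by positivity, fun r hr hr₀ => ?_⟩
  have hr2 : 2 ≤ r := (le_max_left _ _).trans hr₀
  have hrB : B < r := by linarith [(le_max_right 2 (B + 1)).trans hr₀]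
  obtain ⟨κ, hκ, hκ'⟩ := S.exists_displacement_lower_bound hfree ⌊4 * r⌋₊
  -- Beyond this `t`, the four edges of a square neither leave a sheet nor reach the minimal
  -- displacement `κ`.
  refine ⟨4 * r / min ε κ, by positivity, fun t ht ht₀ p₀ => ?_⟩
  rw [div_le_iff₀ (lt_min hε hκ)] at ht₀
  have h1 : 4 * r ≤ t * ε := ht₀.trans (by gcongr; exact min_le_left _ _)
  have h2 : 4 * r ≤ t * κ := ht₀.trans (by gcongr; exact min_le_right _ _)
  let _ := liftGroup.prodAction (p := p) hfree
  exact (isCoarseRegularCover_levelProj (S := S) hcov hs hfree ht (by linarith) hε1 hε2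
    (fun γ hγ => hκ' γ (Nat.le_floor hγ)) h1 h2).nonempty_mulEquiv hr _
      (levelProj_cocycle_trivial hcov.continuous ht hr2 fun f hf => hB r hrB f hf)
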